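/- Let $X$ be a smooth, projective, geometrically irreducible curve over $\mathbb F_q$ with a point $\infty\in X(\mathbb F_q)$, $A=\mathcal O_X(X\setminus\{\infty\})$, $K=\operatorname{Frac}A$, $\Omega=\Omega_{A/\mathbb F_q}$ the module of Kähler differentials, $K_\infty$ the completion of $K$ at $\infty$ for the norm $\|x\|=q^{-v_\infty(x)}$, and $\mathbb C_\infty$ the completion of an algebraic closure of $K_\infty$. Let $\phi$ be a Drinfeld module of rank $r\ge 1$, i.e. a ring homomorphism $A\to\mathbb C_\infty[\tau]$ such that, for $0\neq a\in A$, $\phi_a$ has degree $r\deg a$ in the $q$-Frobenius $\tau$ and constant term $a$. Let $\Lambda\subset\mathbb C_\infty$ be its period lattice: the discrete, finitely generated $A$-submodule of rank $r$ such that $\phi_a(\exp_\Lambda(x))=\exp_\Lambda(ax)$ for all $a\in A$, where $\exp_\Lambda(x)=x\prod_{\lambda\in\Lambda\setminus\{0\}}(1-x/\lambda)$. For an $\mathbb F_q$-vector space $M$ let $\hat M=\operatorname{Hom}_{\mathbb F_q}(M,\mathbb F_q)$ with the topology of pointwise convergence, and let $\mathbb C_\infty\hat\otimes M$ be the space of continuous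 $\mathbb F_q$-linear maps $\hat M\to\mathbb C_\infty$; it contains $\mathbb C_\infty\otimes M$ via $c\otimes m\mapsto(\chi\mapsto\chi(m)c)$ (all tensor products are over $\mathbb F_q$), and its elements can be written as sums $\sum_i c_i\otimes m_i$ with $c_i\to0$. If $M$ is an $A$-module, $\mathbb C_\infty\hat\otimes M$ is a module over $\mathbb C_\infty\otimes A$, where $1\otimes a$ sends $f$ to $\chi\mapsto f(\chi(a\,\cdot))$. For $f\in\mathbb C_\infty\hat\otimes M$ and $j\geq0$, the Frobenius twist $f^{(j)}$ is $\chi\mapsto f(\chi)^{q^j}$, so that $(\sum_i c_i\otimes m_i)^{(j)}=\sum_i c_i^{q^j}\otimes m_i$. Let $\zeta_\phi=-\sum_{\lambda\in\Lambda\setminus\{0\}}\lambda^{-1}\otimes\lambda\in\mathbb C_\infty\hat\otimes\Lambda$ be the universal dual special function. Let $\omega_\phi\in\mathbb C_\infty\hat\otimes\operatorname{Hom}_A(\Lambda,\Omega)$ be the universal special function: identifying the Pontryagin dual of $\operatorname{Hom}_A(\Lambda,\Omega)$ with $K_\infty\Lambda/\Lambda$ through the residue pairing, in which the class of $b\lambda$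 ($b\in K_\infty$, $\lambda\in\Lambda$) is the functional $n\mapsto\operatorname{Res}_\infty(b\,n(\lambda))$, it is the function $c\mapsto\exp_\Lambda(c)$. Let $$ev:(\mathbb C_\infty\hat\otimes\Lambda)\otimes(\mathbb C_\infty\hat\otimes\operatorname{Hom}_A(\Lambda,\Omega))\to\mathbb C_\infty\hat\otimes\Omega,\qquad \Big(\sum_i c_i\otimes\lambda_i\Big)\otimes\Big(\sum_k d_k\otimes n_k\Big)\mapsto\sum_{i,k}c_id_k\otimes n_k(\lambda_i).$$ Then, for all integers $0\le j<r$, $ev(\zeta_\phi\otimes\omega_\phi^{(j)})$ is a rational differential form on $X_{\mathbb C_\infty}$, i.e. some nonzero-divisor of $\mathbb C_\infty\otimes A$ multiplies it into $\mathbb C_\infty\otimes\Omega$. Moreover, if $J\subseteq\mathbb C_\infty\otimes A$ is the ideal generated by the elements $a\otimes1-1\otimes a$, $a\in A$, then $J\cdot ev(\zeta_\phi\otimes\omega_\phi)\subseteq\mathbb C_\infty\otimes\Omega$, and $(\mathbb C_\infty\otimes A)\cdot ev(\zeta_\phi\otimes\omega_\phi^{(j)})\subseteq\mathbb C_\infty\otimes\Omega$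 for $1\le j\le r-1$. -/

import Mathlib

open scoped TensorProduct KaehlerDifferential

namespace DrinfeldPairing

noncomputable section

/-! ### The curve, the place at infinity, and the field `ℂ_∞` -/

/-- Let `K` be the fraction field of `A`.  The smooth projective curve `X` over `Fq` is given by its
function field `K`: the closed points of `X` are the nontrivial valuation rings of `K` containing
`Fq`.  The point `∞` is the valuation ring `O`, and `A = 𝒪_X(X ∖ {∞})` is the ring of all functions
regular at every point other than `∞`.  (`X` is geometrically irreducible because it has the
`Fq`-rational point `∞`.) -/
structure IsRingOfFunctionsAwayFrom (Fq A : Type*) {K : Type*} [Field Fq] [CommRing A] [Field K]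
    [Algebra Fq K] [Algebra A K] (O : ValuationSubring K) : Prop where
  /-- `K` is a finitely generated field extension of `Fq` ... -/
  fg : (⊤ : IntermediateField Fq K).FG
  /-- ... of transcendence degree one. -/
  trdeg_eq_one : Algebra.trdeg Fq K = 1
  /-- `O` is a valuation ring of `K / Fq` ... -/
  algebraMap_mem : ∀ c : Fq, algebraMap Fq K c ∈ O
  /-- ... which is not trivial ... -/
  ne_top : O ≠ ⊤
  /-- ... and whose residue field is `Fq`. -/
  degree_one : ∀ x ∈ O, ∃ c : Fq, x - algebraMap Fq K c ∈ O.nonunits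
  /-- `A` consists of the functions that are regular away from `∞`. -/
  mem_range_iff : ∀ x : K, x ∈ Set.range (algebraMap A K) ↔
    ∀ V : ValuationSubring K, (∀ c : Fq, algebraMap Fq K c ∈ V) → V ≠ O → x ∈ V

/-- The completion `K_∞` of `K`, realised as the closure of `K` in `C = ℂ_∞`. -/
def kInfty (K C : Type*) [Field K] [NormedField C] [Algebra K C] : Subfield C :=
  (algebraMap K C).fieldRange.topologicalClosure

/-- The (complete, nonarchimedean) normed field `C` is `ℂ_∞`: its norm restricts to the normalized `∞`-adic norm
`‖x‖ = q ^ (-v_∞(x))` on `K`, and `C` is the completion of an algebraic closure of `K_∞`. -/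
structure IsCInfty (Fq : Type*) {K : Type*} (C : Type*) [Field Fq] [Fintype Fq] [Field K]
    [NormedField C] [CompleteSpace C] [Algebra K C] (O : ValuationSubring K) : Prop where
  norm_le_one_iff : ∀ x : K, ‖algebraMap K C x‖ ≤ 1 ↔ x ∈ O
  norm_eq_zpow : ∀ x : K, x ≠ 0 → ∃ n : ℤ, ‖algebraMap K C x‖ = (Fintype.card Fq : ℝ) ^ n
  exists_uniformizer : ∃ x : K, ‖algebraMap K C x‖ = (Fintype.card Fq : ℝ)⁻¹
  isAlgClosure : IsAlgClosure (kInfty K C) (algebraicClosure (kInfty K C) C)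
  dense : Dense (algebraicClosure (kInfty K C) C : Set C)

/-! ### Drinfeld modules and their period lattices -/

/-- `φ : A → C[τ] ⊆ End_{Fq}(C)` is a Drinfeld module of rank `r`: for `a ≠ 0`, of degree `d`
(that is, `‖a‖ = q ^ d`), `φ_a` is a polynomial of degree `r * d` in the Frobenius `τ` with
constant term `a`. -/
def IsDrinfeldModule {Fq A C : Type*} [Field Fq] [Fintype Fq] [CommRing A] [NormedField C]
    [Algebra Fq C] [Algebra A C] (φ : A →+* Module.End Fq C) (r : ℕ) : Prop :=
  ∀ a : A, a ≠ 0 → ∃ d : ℕ, ‖algebraMap A C a‖ = (Fintype.card Fq : ℝ) ^ d ∧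
    ∃ c : ℕ → C,
      (∀ x : C, φ a x = ∑ i ∈ Finset.range (r * d + 1), c i * x ^ (Fintype.card Fq ^ i)) ∧
      c 0 = algebraMap A C a ∧ c (r * d) ≠ 0

/-- The exponential function `exp_Λ(x) = x ∏_{λ ∈ Λ ∖ {0}} (1 - x / λ)`. -/
def latticeExp {A C : Type*} [CommRing A] [NormedField C] [Algebra A C] (Λ : Submodule A C)
    (x : C) : C :=
  x * ∏' l : {l : Λ // l ≠ 0}, (1 - x / (l.1 : C))

/-- A subset of `C` is locally finite if it has finitely many elements in each ball. -/
def IsLocallyFinite {A C : Type*} [CommRing A] [NormedField C] [Algebra A C]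
    (Λ : Submodule A C) : Prop :=
  ∀ R : ℝ, {x : C | x ∈ Λ ∧ ‖x‖ ≤ R}.Finite

/-- `Λ` is the period lattice of the Drinfeld module `φ` of rank `r`: a finitely generated discrete
`A`-submodule of `C` of rank `r` with `φ_a (exp_Λ x) = exp_Λ (a x)`. -/
structure IsPeriodLattice {Fq A C : Type*} [Field Fq] [CommRing A] [NormedField C]
    [Algebra Fq C] [Algebra A C] (φ : A →+* Module.End Fq C) (r : ℕ) (Λ : Submodule A C) :
    Prop where
  fg : Λ.FG
  finrank_eq : Module.finrank A Λ = r
  locallyFinite : IsLocallyFinite Λ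
  map_exp : ∀ (a : A) (x : C), φ a (latticeExp Λ x) = latticeExp Λ (algebraMap A C a * x)

/-! ### Pontryagin duals and completed tensor products -/

section Completed

variable (Fq C M : Type*) [Field Fq] [NormedField C] [Algebra Fq C] [AddCommGroup M] [Module Fq M]

/-- The topology of the Pontryagin dual `Hom_{Fq}(M, Fq)` of the discrete `Fq`-vector space `M`:
pointwise convergence, `Fq` being discrete. -/
@[reducible]
def dualTopology : TopologicalSpace (Module.Dual Fq M) :=
  TopologicalSpace.induced (fun χ m => χ m) (@Pi.topologicalSpace M (fun _ => Fq) fun _ => ⊥)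

variable {Fq C M}

theorem continuous_dual_iff (f : Module.Dual Fq M →ₗ[Fq] C) :
    @Continuous _ _ (dualTopology Fq M) _ f ↔
      ∀ ε > 0, ∃ S : Finset M, ∀ χ : Module.Dual Fq M, (∀ m ∈ S, χ m = 0) → ‖f χ‖ < ε := by
  let _ : TopologicalSpace Fq := ⊥
  have : DiscreteTopology Fq := ⟨rfl⟩
  let _ : TopologicalSpace (Module.Dual Fq M) := dualTopology Fq M
  have key : ∀ (χ₀ : Module.Dual Fq M) (s : Set (Module.Dual Fq M)), s ∈ nhds χ₀ ↔
      ∃ S : Finset M, ∀ χ : Module.Dual Fq M, (∀ m ∈ S, χ m = χ₀ m) → χ ∈ s := by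
    intro χ₀ s
    have : nhds χ₀ = Filter.comap (fun (χ : Module.Dual Fq M) (m : M) => χ m)
        (nhds (fun m => χ₀ m)) := nhds_induced _ _
    rw [this, Filter.mem_comap]
    constructor
    · rintro ⟨t, ht, hts⟩
      rw [nhds_pi, Filter.mem_pi'] at ht
      obtain ⟨S, u, hu, hut⟩ := ht
      refine ⟨S, fun χ hχ => hts (hut fun m hm => ?_)⟩
      change χ m ∈ u m
      rw [hχ m hm]
      exact mem_of_mem_nhds (hu m)
    · rintro ⟨S, hS⟩
      refine ⟨(S : Set M).pi fun m => {χ₀ m}, set_pi_mem_nhds S.finite_toSet fun m _ => by simp, ?_⟩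
      intro χ hχ
      exact hS χ fun m hm => hχ m hm
  constructor
  · intro hf ε hε
    have h0 : f ⁻¹' Metric.ball 0 ε ∈ nhds (0 : Module.Dual Fq M) :=
      hf.continuousAt.preimage_mem_nhds (by rw [map_zero]; exact Metric.ball_mem_nhds _ hε)
    obtain ⟨S, hS⟩ := (key _ _).1 h0
    refine ⟨S, fun χ hχ => ?_⟩
    simpa using hS χ (by simpa using hχ)
  · intro h
    rw [continuous_iff_continuousAt]
    intro χ₀
    rw [ContinuousAt, Metric.tendsto_nhds]
    intro ε hε
    obtain ⟨S, hS⟩ := h ε hε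
    refine (key _ _).2 ⟨S, fun χ hχ => ?_⟩
    have := hS (χ - χ₀) fun m hm => by simp [hχ m hm]
    simpa [dist_eq_norm] using this

variable (Fq C M)

/-- The completed tensor product `C ⊗̂ M := Hom_{Fq}^{cont}(Hom_{Fq}(M, Fq), C)` for a discrete
`Fq`-vector space `M`. -/
def CTensor : Submodule C (Module.Dual Fq M →ₗ[Fq] C) where
  carrier := {f | @Continuous _ _ (dualTopology Fq M) _ f}
  add_mem' {f g} hf hg := by
    let _ : TopologicalSpace (Module.Dual Fq M) := dualTopology Fq M
    exact Continuous.add (f := fun χ => f χ) (g := fun χ => g χ) hf hg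
  zero_mem' := by
    let _ : TopologicalSpace (Module.Dual Fq M) := dualTopology Fq M
    exact continuous_const (y := (0 : C))
  smul_mem' c f hf := by
    let _ : TopologicalSpace (Module.Dual Fq M) := dualTopology Fq M
    exact Continuous.mul (f := fun _ => c) (g := fun χ => f χ) continuous_const hf

variable {Fq C M}

theorem mem_CTensor_iff (f : Module.Dual Fq M →ₗ[Fq] C) : f ∈ CTensor Fq C M ↔
    ∀ ε > 0, ∃ S : Finset M, ∀ χ : Module.Dual Fq M, (∀ m ∈ S, χ m = 0) → ‖f χ‖ < ε :=
  continuous_dual_iff f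

theorem CTensor.tendsto_coord {ι : Type*} (z : CTensor Fq C M)
    (b : Module.Basis ι Fq M) :
    Filter.Tendsto (fun i => z.1 (b.coord i)) Filter.cofinite (nhds 0) := by
  classical
  rw [Metric.tendsto_nhds]
  intro ε hε
  obtain ⟨S, hS⟩ := (mem_CTensor_iff _).1 z.2 ε hε
  rw [Filter.eventually_cofinite]
  refine (S.biUnion fun m => (b.repr m).support).finite_toSet.subset fun i hi => ?_
  by_contra hcon
  refine hi ?_
  rw [dist_zero_right]
  refine hS _ fun m hm => ?_
  simp only [Finset.mem_coe, Finset.mem_biUnion, not_exists, not_and] at hcon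
  simpa using hcon m hm

variable (Fq C M)

/-- The canonical map `C ⊗ M → C ⊗̂ M`, sending `c ⊗ m` to `χ ↦ χ(m) c`. -/
def ofTensor : C ⊗[Fq] M →ₗ[Fq] CTensor Fq C M :=
  TensorProduct.lift
    { toFun := fun c =>
        { toFun := fun m => ⟨(Module.Dual.eval Fq M m).smulRight c, by
            rw [mem_CTensor_iff]
            intro ε hε
            exact ⟨{m}, fun χ hχ => by simpa [hχ m (by simp)] using hε⟩⟩
          map_add' := fun m n => by ext χ; simp [add_smul]
          map_smul' := fun k m => by ext χ; simp [mul_smul] }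
      map_add' := fun c d => by ext m χ; simp
      map_smul' := fun k c => by ext m χ; simp [smul_comm k] }

variable (A : Type*) [CommRing A] [Algebra Fq A] [Module A M] [IsScalarTower Fq A M]

variable {Fq C M A} in
/-- The action of `1 ⊗ a` on `C ⊗̂ M`: `((1 ⊗ a) f)(χ) = f (m ↦ χ (a m))`. -/
def rightMul (a : A) (f : CTensor Fq C M) : CTensor Fq C M :=
  ⟨f.1 ∘ₗ (Algebra.lsmul Fq Fq M a).dualMap, by
    classical
    rw [mem_CTensor_iff]
    intro ε hε
    obtain ⟨S, hS⟩ := (mem_CTensor_iff _).1 f.2 ε hε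
    refine ⟨S.image (a • ·), fun χ hχ => hS _ fun m hm => ?_⟩
    exact hχ _ (Finset.mem_image_of_mem _ hm)⟩

variable {Fq C M A} in
/-- The map `h ↦ h f` from `C ⊗ A` to `C ⊗̂ M`, for `f ∈ C ⊗̂ M`, with
`(c ⊗ a) f = c ((1 ⊗ a) f)`. -/
def tensorSMulHom (f : CTensor Fq C M) : C ⊗[Fq] A →ₗ[Fq] CTensor Fq C M :=
  TensorProduct.lift
    { toFun := fun c =>
        { toFun := fun a => c • rightMul a f
          map_add' := fun a b => by
            rw [← smul_add]
            refine congrArg (c • ·) (Subtype.ext (LinearMap.ext fun χ => ?_))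
            refine (congrArg f.1 (LinearMap.ext fun m => ?_)).trans (map_add f.1 _ _)
            simp
          map_smul' := fun k a => by
            rw [RingHom.id_apply, smul_comm k c]
            refine congrArg (c • ·) (Subtype.ext (LinearMap.ext fun χ => ?_))
            refine (congrArg f.1 (LinearMap.ext fun m => ?_)).trans (map_smul f.1 k _)
            simp }
      map_add' := fun c d => LinearMap.ext fun a => add_smul c d _
      map_smul' := fun k c => LinearMap.ext fun a => smul_assoc k c _ }

/-- The action of `C ⊗ A` on `C ⊗̂ M`, for an `A`-module `M`. -/
def tensorAction (h : C ⊗[Fq] A) (f : CTensor Fq C M) : CTensor Fq C M :=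
  tensorSMulHom f h

theorem tensorAction_tmul (c : C) (a : A) (f : CTensor Fq C M) (χ : Module.Dual Fq M) :
    (tensorAction Fq C M A (c ⊗ₜ a) f).1 χ = c * f.1 (χ ∘ₗ Algebra.lsmul Fq Fq M a) :=
  rfl

variable {Fq C M}

/-- An element of `C ⊗̂ M` is rational if it becomes an element of `C ⊗ M` after multiplication by
some nonzerodivisor of `C ⊗ A`, i.e. if it lies in `Frac(C ⊗ A) ⊗ M`.  For `M = Ω` these are the
rational differential forms on `X_C`. -/
def IsRational (η : CTensor Fq C M) : Prop :=
  ∃ h ∈ nonZeroDivisors (C ⊗[Fq] A), tensorAction Fq C M A h η ∈ LinearMap.range (ofTensor Fq C M)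

variable (Fq C) in
/-- The ideal `J` of `C ⊗ A` generated by the elements `a ⊗ 1 - 1 ⊗ a`. -/
def diagonalIdeal [Algebra A C] : Ideal (C ⊗[Fq] A) :=
  Ideal.span (Set.range fun a : A => algebraMap A C a ⊗ₜ[Fq] (1 : A) - (1 : C) ⊗ₜ[Fq] a)

/-- The Frobenius twist `f ↦ f^{(j)}` on `C ⊗̂ M`, sending `∑ c_i ⊗ m_i` to
`∑ c_i ^ (q ^ j) ⊗ m_i`; equivalently `f^{(j)}(χ) = f(χ) ^ (q ^ j)`. -/
def twist [Fintype Fq] (j : ℕ) (f : CTensor Fq C M) : CTensor Fq C M :=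
  ⟨((FiniteField.frobeniusAlgHom Fq C) ^ j).toLinearMap ∘ₗ f.1, by
    let _ : TopologicalSpace (Module.Dual Fq M) := dualTopology Fq M
    have hf : Continuous fun χ => f.1 χ := f.2
    have : (fun χ => (((FiniteField.frobeniusAlgHom Fq C) ^ j).toLinearMap ∘ₗ f.1) χ) =
        fun χ => f.1 χ ^ Fintype.card Fq ^ j := by
      funext χ
      simp [AlgHom.coe_pow, FiniteField.coe_frobeniusAlgHom, pow_iterate]
    change Continuous fun χ => (((FiniteField.frobeniusAlgHom Fq C) ^ j).toLinearMap ∘ₗ f.1) χ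
    rw [this]
    exact hf.pow _⟩

end Completed

/-! ### The pairing `ev` -/

section Pairing

variable {Fq C : Type*} [Field Fq] [Fintype Fq] [NormedField C] [Algebra Fq C]

theorem norm_algebraMap_le_one (k : Fq) : ‖algebraMap Fq C k‖ ≤ 1 := by
  rcases eq_or_ne k 0 with rfl | hk
  · simp
  · refine (IsOfFinOrder.norm_eq_one ?_).le
    have h : IsOfFinOrder (Units.mk0 k hk) := isOfFinOrder_of_finite _
    exact ((algebraMap Fq C).toMonoidHom.isOfFinOrder
      ((Units.coeHom Fq).isOfFinOrder h) :)

theorem norm_smul_le' (k : Fq) (c : C) : ‖k • c‖ ≤ ‖c‖ := by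
  rw [Algebra.smul_def, norm_mul]
  exact mul_le_of_le_one_left (norm_nonneg _) (norm_algebraMap_le_one k)

theorem CTensor.exists_bound {M : Type*} [AddCommGroup M] [Module Fq M] (w : CTensor Fq C M) :
    ∃ B > 0, ∀ χ, ‖w.1 χ‖ ≤ B := by
  classical
  obtain ⟨S, hS⟩ := (mem_CTensor_iff _).1 w.2 1 one_pos
  let g : Module.Dual Fq M → (S → Fq) := fun χ m => χ m
  let e : (S → Fq) → Module.Dual Fq M := fun u => if h : ∃ χ, g χ = u then h.choose else 0
  have he : ∀ χ, g (e (g χ)) = g χ := fun χ => by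
    have h : ∃ χ', g χ' = g χ := ⟨χ, rfl⟩
    simp only [e, dif_pos h]
    exact h.choose_spec
  refine ⟨1 + ∑ u, ‖w.1 (e u)‖, by positivity, fun χ => ?_⟩
  have h1 : ‖w.1 (χ - e (g χ))‖ < 1 := hS _ fun m hm => by
    have := congrFun (he χ) ⟨m, hm⟩
    simp only [g] at this
    simp [this, g]
  have h2 : ‖w.1 (e (g χ))‖ ≤ ∑ u, ‖w.1 (e u)‖ :=
    Finset.single_le_sum (f := fun u => ‖w.1 (e u)‖) (fun _ _ => norm_nonneg _)
      (Finset.mem_univ _)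
  calc ‖w.1 χ‖ = ‖w.1 (χ - e (g χ)) + w.1 (e (g χ))‖ := by rw [← map_add, sub_add_cancel]
    _ ≤ _ := (norm_add_le _ _).trans (add_le_add h1.le h2)

variable [CompleteSpace C] [IsUltrametricDist C]
  {A L P : Type*} [CommRing A] [Algebra Fq A]
  [AddCommGroup L] [Module A L] [Module Fq L]
  [AddCommGroup P] [Module A P] [Module Fq P] [IsScalarTower Fq A P]

/-- For `l ∈ L`, the map `Hom_{Fq}(P, Fq) → Hom_{Fq}(Hom_A(L, P), Fq)` sending `χ` to
`n ↦ χ (n l)`. -/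
def dualEval (l : L) : Module.Dual Fq P →ₗ[Fq] Module.Dual Fq (L →ₗ[A] P) :=
  LinearMap.dualMap
    { toFun := fun n : L →ₗ[A] P => n l
      map_add' := fun _ _ => rfl
      map_smul' := fun _ _ => rfl }

theorem ev_tendsto (z : CTensor Fq C L) (w : CTensor Fq C (L →ₗ[A] P)) {ι : Type*}
    (b : Module.Basis ι Fq L) (χ : Module.Dual Fq P) :
    Filter.Tendsto (fun i => z.1 (b.coord i) * w.1 (dualEval (b i) χ)) Filter.cofinite
      (nhds 0) := by
  obtain ⟨B, hB, hw⟩ := CTensor.exists_bound w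
  refine squeeze_zero_norm (a := fun i => ‖z.1 (b.coord i)‖ * B) (fun i => ?_) ?_
  · rw [norm_mul]
    exact mul_le_mul_of_nonneg_left (hw _) (norm_nonneg _)
  · simpa using (CTensor.tendsto_coord z b).norm.mul_const B

theorem ev_summable (z : CTensor Fq C L) (w : CTensor Fq C (L →ₗ[A] P)) {ι : Type*}
    (b : Module.Basis ι Fq L) (χ : Module.Dual Fq P) :
    Summable (fun i => z.1 (b.coord i) * w.1 (dualEval (b i) χ)) :=
  NonarchimedeanAddGroup.summable_of_tendsto_cofinite_zero (ev_tendsto z w b χ)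

/-- The evaluation pairing `ev : (C ⊗̂ L) × (C ⊗̂ Hom_A(L, P)) → C ⊗̂ P`.  Writing
`z = ∑ c_i ⊗ l_i` for an `Fq`-basis `(l_i)` of `L` (so that `c_i = z(l_i^*)` tends to zero) and
`w = ∑ d_k ⊗ n_k`, it is `ev(z ⊗ w) = ∑ c_i d_k ⊗ n_k(l_i)`, i.e.
`ev(z ⊗ w)(χ) = ∑ c_i w(n ↦ χ(n(l_i)))`. -/
def ev (z : CTensor Fq C L) (w : CTensor Fq C (L →ₗ[A] P)) : CTensor Fq C P :=
  let b := Module.Basis.ofVectorSpace Fq L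
  ⟨{ toFun := fun χ => ∑' i, z.1 (b.coord i) * w.1 (dualEval (b i) χ)
     map_add' := fun χ ψ => by
      rw [← (ev_summable z w b χ).tsum_add (ev_summable z w b ψ)]
      simp [mul_add]
     map_smul' := fun k χ => by
      simp only [map_smul, RingHom.id_apply, mul_smul_comm]
      simp only [Algebra.smul_def]
      rw [tsum_mul_left] }, by
    classical
    rw [mem_CTensor_iff]
    intro ε hε
    obtain ⟨B, hB, hw⟩ := CTensor.exists_bound w
    have hz := (Metric.tendsto_nhds.1 (CTensor.tendsto_coord z b)) (ε / 2 / B) (by positivity)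
    rw [Filter.eventually_cofinite] at hz
    have hS : ∀ i, ∃ S : Finset P, ∀ χ : Module.Dual Fq P, (∀ m ∈ S, χ m = 0) →
        ‖z.1 (b.coord i) * w.1 (dualEval (b i) χ)‖ ≤ ε / 2 := fun i => by
      obtain ⟨T, hT⟩ := (mem_CTensor_iff _).1 w.2 (ε / 2 / (‖z.1 (b.coord i)‖ + 1))
        (by positivity)
      refine ⟨T.image fun n => n (b i), fun χ hχ => ?_⟩
      have h := hT (dualEval (b i) χ) fun n hn => hχ _ (Finset.mem_image_of_mem _ hn)
      rw [norm_mul]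
      calc ‖z.1 (b.coord i)‖ * ‖w.1 (dualEval (b i) χ)‖
          ≤ (‖z.1 (b.coord i)‖ + 1) * (ε / 2 / (‖z.1 (b.coord i)‖ + 1)) := by
            gcongr
            linarith
        _ = ε / 2 := by field_simp
    choose S hS using hS
    refine ⟨hz.toFinset.biUnion S, fun χ hχ => ?_⟩
    refine lt_of_le_of_lt ?_ (half_lt_self hε)
    refine (IsUltrametricDist.norm_tsum_le _).trans (Real.iSup_le (fun i => ?_) (by positivity))
    by_cases hi : i ∈ hz.toFinset
    · exact hS i χ fun m hm => hχ m (Finset.mem_biUnion.2 ⟨i, hi, hm⟩)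
    · have hi' : ‖z.1 (b.coord i)‖ < ε / 2 / B := by simpa using hi
      rw [norm_mul]
      calc ‖z.1 (b.coord i)‖ * ‖w.1 (dualEval (b i) χ)‖ ≤ (ε / 2 / B) * B := by
            gcongr
            exact hw _
        _ = ε / 2 := by field_simp⟩

end Pairing

/-! ### The universal dual special function -/

section Zeta

theorem tendsto_inv_lattice {A C : Type*} [CommRing A] [NormedField C] [Algebra A C]
    {Λ : Submodule A C} (hΛ : IsLocallyFinite Λ) :
    Filter.Tendsto (fun l : {l : Λ // l ≠ 0} => ((l.1 : C))⁻¹) Filter.cofinite (nhds 0) := by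
  rw [Metric.tendsto_nhds]
  intro ε hε
  rw [Filter.eventually_cofinite]
  have hinj : Function.Injective fun l : {l : Λ // l ≠ 0} => (l.1 : C) :=
    Subtype.val_injective.comp Subtype.val_injective
  refine ((hΛ ε⁻¹).preimage hinj.injOn).subset fun l hl => ⟨l.1.2, ?_⟩
  have h : ε ≤ ‖(l.1 : C)‖⁻¹ := by simpa using hl
  exact (le_inv_comm₀ hε ((lt_of_lt_of_le hε h).trans_le le_rfl |> inv_pos.1)).1 h

variable {Fq A C : Type*} [Field Fq] [Fintype Fq] [CommRing A] [NormedField C] [CompleteSpace C]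
  [IsUltrametricDist C] [Algebra Fq A] [Algebra Fq C] [Algebra A C] [IsScalarTower Fq A C]

theorem zeta_summable {Λ : Submodule A C} (hΛ : IsLocallyFinite Λ) (χ : Module.Dual Fq Λ) :
    Summable fun l : {l : Λ // l ≠ 0} => χ l.1 • ((l.1 : C))⁻¹ := by
  refine NonarchimedeanAddGroup.summable_of_tendsto_cofinite_zero ?_
  refine squeeze_zero_norm (fun l => norm_smul_le' _ _) ?_
  simpa using (tendsto_inv_lattice hΛ).norm

variable (Fq) in
/-- The universal dual special function `ζ_φ = -∑_{λ ∈ Λ ∖ {0}} λ⁻¹ ⊗ λ ∈ C ⊗̂ Λ`, i.e. the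
continuous map `χ ↦ -∑_{λ ∈ Λ ∖ {0}} χ(λ) λ⁻¹`. -/
def universalZeta (Λ : Submodule A C) (hΛ : IsLocallyFinite Λ) : CTensor Fq C Λ :=
  ⟨{ toFun := fun χ => -∑' l : {l : Λ // l ≠ 0}, χ l.1 • ((l.1 : C))⁻¹
     map_add' := fun χ ψ => by
      rw [← neg_add, ← (zeta_summable hΛ χ).tsum_add (zeta_summable hΛ ψ)]
      simp [add_smul]
     map_smul' := fun k χ => by
      simp only [LinearMap.smul_apply, smul_eq_mul, mul_smul, RingHom.id_apply, smul_neg]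
      simp only [Algebra.smul_def k]
      rw [tsum_mul_left] }, by
    classical
    rw [mem_CTensor_iff]
    intro ε hε
    have hz := (Metric.tendsto_nhds.1 (tendsto_inv_lattice hΛ)) (ε / 2) (by positivity)
    rw [Filter.eventually_cofinite] at hz
    refine ⟨hz.toFinset.image Subtype.val, fun χ hχ => ?_⟩
    refine lt_of_le_of_lt ?_ (half_lt_self hε)
    simp only [LinearMap.coe_mk, AddHom.coe_mk, norm_neg]
    refine (IsUltrametricDist.norm_tsum_le _).trans (Real.iSup_le (fun l => ?_) (by positivity))
    by_cases hl : l ∈ hz.toFinset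
    · rw [hχ _ (Finset.mem_image_of_mem _ hl), zero_smul, norm_zero]
      positivity
    · have hl' : ‖((l.1 : C))⁻¹‖ < ε / 2 := by simpa using hl
      exact (norm_smul_le' _ _).trans hl'.le⟩

end Zeta

/-! ### Residues at infinity and the universal special function -/

section Omega

variable {Fq A K C : Type*} [Field Fq] [Fintype Fq] [CommRing A] [Field K] [NormedField C]
  [Algebra Fq A] [Algebra Fq K] [Algebra Fq C] [Algebra A K] [Algebra A C] [Algebra K C]
  [IsScalarTower Fq A K] [IsScalarTower Fq A C]

/-- `x` is the residue at `∞` of the differential form `b η`, where `b ∈ K_∞` and `η ∈ Ω`: writing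
`η = h dπ` with `h ∈ K` and expanding `b h = ∑_n c_n π ^ n` in `K_∞ = Fq((π))`, it is `c_{-1}`.
Here `π ∈ K` is a uniformizer at `∞`. -/
def IsResidue (π : K) (b : C) (η : Ω[A⁄Fq]) (x : Fq) : Prop :=
  ∃ h : K, KaehlerDifferential.map Fq Fq A K η = h • KaehlerDifferential.D Fq K π ∧
    ∃ c : ℤ → Fq, HasSum (fun n : ℤ => c n • (algebraMap K C π) ^ n) (b * algebraMap K C h) ∧
      c (-1) = x

variable (Fq) in
/-- `w ∈ C ⊗̂ Hom_A(Λ, Ω)` corresponds to `exp_Λ`.  The Pontryagin dual of `Hom_A(Λ, Ω)` is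
`K_∞ Λ / Λ`, the class of `b λ` (for `b ∈ K_∞` and `λ ∈ Λ`) being the functional
`n ↦ Res_∞(b n(λ))`; the condition says that `w`, as a function on this dual, is
`c ↦ exp_Λ(c)`. As these classes generate the dual, at most one `w` has this property. -/
def IsExponential (π : K) (Λ : Submodule A C) (w : CTensor Fq C (Λ →ₗ[A] Ω[A⁄Fq])) : Prop :=
  ∀ b ∈ kInfty K C, ∀ (l : Λ) (χ : Module.Dual Fq (Λ →ₗ[A] Ω[A⁄Fq])),
    (∀ n, IsResidue π b (n l) (χ n)) → w.1 χ = latticeExp Λ (b * l)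

open Classical in
variable (Fq) in
/-- The universal special function `ω_φ ∈ C ⊗̂ Hom_A(Λ, Ω)`: the element which, as a function on
the Pontryagin dual `K_∞ Λ / Λ` of `Hom_A(Λ, Ω)`, is the exponential function `exp_Λ`. -/
def universalOmega (π : K) (Λ : Submodule A C) : CTensor Fq C (Λ →ₗ[A] Ω[A⁄Fq]) :=
  if h : ∃ w, IsExponential Fq π Λ w then h.choose else 0

end Omega

end

end DrinfeldPairing

namespace DrinfeldPairing

/-! ### Infinite products in complete ultrametric fields -/

section Products

variable {C ι : Type*} [NormedField C] [IsUltrametricDist C]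

/-! Unwinding `ev` and `universalZeta`, the value of ev(ζ ⊗ ω^(j)) at a functional χ on Ω is -∑_{λ ≠
0} ω(n ↦ χ(n(λ)))^(q^j) / λ (`ev_universalZeta_apply`). When χ = Res_∞(b ·) with b ∈ K_∞, this is -∑
exp_Λ(bλ)^(q^j) / λ.

The heart of the matter is that for small b this value is b if j = 0 and zero if j > 0
(`exists_forall_tsum_latticeExp_eq`). Truncate exp_Λ to the polynomial E_R whose roots are the
lattice points of norm at most R, and truncate the sum to the lattice points of norm at most cR,
where c is chosen so that the larger ball has more than q^j times as many points. Then E_R(bx)^(q^j)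
/ x is a polynomial in x whose degree is too small for its sum over the finite group of points of
the larger ball to be nonzero (`sum_eval_eq_zero_of_degree_lt`). The sum over the nonzero points is
therefore minus the value at x = 0, which is b or 0. If ‖b‖ < 1/c, both truncation errors are
O(1/R).

Small b suffice. An element of C ⊗̂ Ω lies in C ⊗ Ω exactly when it kills all functionals vanishing
on some finite set (`mem_range_ofTensor_iff`). Only finitely many elements of Ω have a given bound
on their pole at ∞, and a functional vanishing on those is Res_∞(b ·) with b small
(`exists_forall_dual_eq_residue`). For j > 0 this already gives membership in C ⊗ Ω. For j = 0, a ⊗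
1 multiplies the value b by a, while 1 ⊗ a replaces b by ab, so a ⊗ 1 - 1 ⊗ a carries the form into
C ⊗ Ω. Rationality follows because t ⊗ 1 - 1 ⊗ t is a nonzerodivisor for nonconstant t
(`diagonal_mem_nonZeroDivisors`). -/

theorem norm_sub_le_of_le {x y : C} {δ : ℝ} (hx : ‖x‖ ≤ δ) (hy : ‖y‖ ≤ δ) : ‖x - y‖ ≤ δ := by
  rw [sub_eq_add_neg]
  exact (IsUltrametricDist.norm_add_le_max x (-y)).trans (max_le hx (by rwa [norm_neg]))

theorem norm_add_le_of_le {x y : C} {δ : ℝ} (hx : ‖x‖ ≤ δ) (hy : ‖y‖ ≤ δ) : ‖x + y‖ ≤ δ :=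
  (IsUltrametricDist.norm_add_le_max x y).trans (max_le hx hy)

theorem norm_eq_of_norm_sub_lt {x y : C} (h : ‖x - y‖ < ‖y‖) : ‖x‖ = ‖y‖ := by
  have := IsUltrametricDist.norm_add_eq_max_of_norm_ne_norm h.ne
  rwa [sub_add_cancel, max_eq_right h.le] at this

theorem norm_prod_one_sub_sub_one_le (u : ι → C) (T : Finset ι) {δ : ℝ} (h0 : 0 ≤ δ) (h1 : δ ≤ 1)
    (h : ∀ i ∈ T, ‖u i‖ ≤ δ) : ‖∏ i ∈ T, (1 - u i) - 1‖ ≤ δ := by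
  classical
  induction T using Finset.induction_on with
  | empty => simpa using h0
  | insert i T hi ih =>
    have ih := ih fun k hk => h k (Finset.mem_insert_of_mem hk)
    have hP : ‖∏ k ∈ T, (1 - u k)‖ ≤ 1 := by
      have := norm_add_le_of_le (ih.trans h1) (norm_one (α := C)).le
      rwa [sub_add_cancel] at this
    rw [Finset.prod_insert hi]
    have : (1 - u i) * ∏ k ∈ T, (1 - u k) - 1 =
        (∏ k ∈ T, (1 - u k) - 1) - u i * ∏ k ∈ T, (1 - u k) := by ring
    rw [this]
    refine norm_sub_le_of_le ih ?_
    rw [norm_mul]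
    calc ‖u i‖ * ‖∏ k ∈ T, (1 - u k)‖ ≤ δ * 1 :=
          mul_le_mul (h i (Finset.mem_insert_self _ _)) hP (norm_nonneg _) h0
      _ = δ := mul_one δ

/-- The extra factors are within δ of 1, hence so is their product by the ultrametric inequality;
the error is thus relative to the product over S. -/
theorem norm_prod_sub_prod_le [DecidableEq ι] (u : ι → C) {S T : Finset ι} (hST : S ⊆ T) {δ : ℝ}
    (h0 : 0 ≤ δ) (h1 : δ ≤ 1) (h : ∀ i ∉ S, ‖u i‖ ≤ δ) :
    ‖∏ i ∈ T, (1 - u i) - ∏ i ∈ S, (1 - u i)‖ ≤ ‖∏ i ∈ S, (1 - u i)‖ * δ := by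
  have : ∏ i ∈ T, (1 - u i) - ∏ i ∈ S, (1 - u i) =
      (∏ i ∈ S, (1 - u i)) * (∏ i ∈ T \ S, (1 - u i) - 1) := by
    rw [mul_sub, mul_one, mul_comm, Finset.prod_sdiff hST]
  rw [this, norm_mul]
  refine mul_le_mul_of_nonneg_left ?_ (norm_nonneg _)
  exact norm_prod_one_sub_sub_one_le u _ h0 h1 fun i hi => h i (Finset.mem_sdiff.1 hi).2

/-- Once S contains all indices with ‖u i‖ > 1, the partial products are bounded by a fixed M, so
the relative error bound becomes an absolute one and the partial products are Cauchy. -/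
theorem multipliable_one_sub [CompleteSpace C] {u : ι → C}
    (hu : Filter.Tendsto u Filter.cofinite (nhds 0)) : Multipliable fun i => 1 - u i := by
  classical
  have hfin : ∀ ε > 0, ∃ S : Finset ι, ∀ i ∉ S, ‖u i‖ ≤ ε := fun ε hε => by
    have := (Metric.tendsto_nhds.1 hu) ε hε
    rw [Filter.eventually_cofinite] at this
    refine ⟨this.toFinset, fun i hi => ?_⟩
    have hi' : ‖u i‖ < ε := by simpa using hi
    exact hi'.le
  obtain ⟨S₀, hS₀⟩ := hfin 1 one_pos
  set M := ‖∏ i ∈ S₀, (1 - u i)‖ with hM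
  have hM0 : 0 ≤ M := norm_nonneg _
  have hbound : ∀ S, S₀ ⊆ S → ‖∏ i ∈ S, (1 - u i)‖ ≤ M := fun S hS => by
    have h := norm_prod_sub_prod_le u hS zero_le_one le_rfl hS₀
    rw [mul_one] at h
    have h' := norm_add_le_of_le h hM.ge
    rwa [sub_add_cancel] at h'
  have hc : CauchySeq fun S : Finset ι => ∏ i ∈ S, (1 - u i) := by
    rw [Metric.cauchySeq_iff']
    intro ε hε
    obtain ⟨S₁, hS₁⟩ := hfin (min 1 (ε / 2 / (M + 1))) (by positivity)
    refine ⟨S₀ ∪ S₁, fun T hT => ?_⟩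
    rw [dist_eq_norm]
    have h := norm_prod_sub_prod_le u hT (δ := min 1 (ε / 2 / (M + 1)))
      (by positivity) (min_le_left _ _)
      fun i hi => hS₁ i fun h => hi (Finset.mem_union_right _ h)
    calc _ ≤ _ := h
      _ ≤ (M + 1) * (ε / 2 / (M + 1)) := by
        refine mul_le_mul ((hbound _ Finset.subset_union_left).trans (by linarith))
          (min_le_right _ _) (by positivity) (by positivity)
      _ = ε / 2 := by field_simp
      _ < ε := half_lt_self hε
  obtain ⟨a, ha⟩ := cauchySeq_tendsto_of_complete hc
  exact ⟨a, by simpa [HasProd] using ha⟩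

theorem norm_tprod_sub_prod_le [CompleteSpace C] {u : ι → C}
    (hu : Filter.Tendsto u Filter.cofinite (nhds 0)) (S : Finset ι) {δ : ℝ}
    (h0 : 0 ≤ δ) (h1 : δ ≤ 1) (h : ∀ i ∉ S, ‖u i‖ ≤ δ) :
    ‖∏' i, (1 - u i) - ∏ i ∈ S, (1 - u i)‖ ≤ ‖∏ i ∈ S, (1 - u i)‖ * δ := by
  classical
  have ht : Filter.Tendsto (fun T : Finset ι => ∏ i ∈ T, (1 - u i)) Filter.atTop
      (nhds (∏' i, (1 - u i))) := by
    simpa [HasProd] using (multipliable_one_sub hu).hasProd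
  refine le_of_tendsto (ht.sub_const _).norm ?_
  filter_upwards [Filter.eventually_ge_atTop S] with T hT
  exact norm_prod_sub_prod_le u hT h0 h1 h

end Products

/-! ### Power sums over finite additive subgroups of a field -/

open Polynomial in
-- By Lagrange interpolation the coefficient of X^(|V|-1) in G is ∑ G(x) / ∏_{y ≠ x} (x - y). Since
-- V is a group, every denominator equals the product of the nonzero elements of V, so the sum is a
-- constant times a coefficient that vanishes.
theorem sum_eval_eq_zero_of_degree_lt {F : Type*} [Field F] {V : Finset F}
    (hsub : ∀ x ∈ V, ∀ y ∈ V, x - y ∈ V) {G : F[X]}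
    (hG : G.natDegree + 1 < V.card) : ∑ x ∈ V, G.eval x = 0 := by
  classical
  have hdeg : G.degree < (V.card : WithBot ℕ) :=
    lt_of_le_of_lt degree_le_natDegree (by exact_mod_cast (by omega))
  have h := Lagrange.coeff_eq_sum (s := V) (v := id) (Set.injOn_id _) hdeg
  rw [coeff_eq_zero_of_natDegree_lt (by omega)] at h
  have hprod : ∀ x ∈ V, ∏ y ∈ V.erase x, (id x - id y) = ∏ y ∈ V.erase 0, y := fun x hx => by
    refine Finset.prod_nbij' (fun y => x - y) (fun y => x - y) ?_ ?_ ?_ ?_ ?_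
    · intro y hy
      rw [Finset.mem_erase] at hy ⊢
      exact ⟨sub_ne_zero.2 hy.1.symm, hsub x hx y hy.2⟩
    · intro y hy
      rw [Finset.mem_erase] at hy ⊢
      exact ⟨fun h => hy.1 (by simpa using h), hsub x hx y hy.2⟩
    · intro y _; simp
    · intro y _; simp
    · intro y _; simp
  have hne : ∏ y ∈ V.erase 0, y ≠ 0 := Finset.prod_ne_zero_iff.2 fun y hy => (Finset.mem_erase.1 hy).1
  rw [Finset.sum_congr rfl fun x hx => by rw [hprod x hx], ← Finset.sum_div, eq_comm,
    div_eq_zero_iff] at h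
  simpa using h.resolve_right hne

/-! ### Elements of `C ⊗ M` inside `C ⊗̂ M` -/

section Finite

variable {Fq C M : Type*} [Field Fq] [NormedField C] [Algebra Fq C] [AddCommGroup M] [Module Fq M]

theorem ofTensor_tmul_apply (c : C) (m : M) (χ : Module.Dual Fq M) :
    (ofTensor Fq C M (c ⊗ₜ m)).1 χ = χ m • c :=
  rfl

/-- A functional killed under such a vanishing condition makes f factor through restriction to the
finite-dimensional span W of S, and a dual basis of W then writes f as a finite sum of pure tensors.
-/
theorem mem_range_ofTensor_iff (f : CTensor Fq C M) :
    f ∈ LinearMap.range (ofTensor Fq C M) ↔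
      ∃ S : Finset M, ∀ χ : Module.Dual Fq M, (∀ m ∈ S, χ m = 0) → f.1 χ = 0 := by
  classical
  constructor
  · rintro ⟨x, rfl⟩
    induction x with
    | zero => exact ⟨∅, fun χ _ => by simp⟩
    | tmul c m => exact ⟨{m}, fun χ hχ => by simp [ofTensor_tmul_apply, hχ m (by simp)]⟩
    | add x y hx hy =>
      obtain ⟨S, hS⟩ := hx
      obtain ⟨T, hT⟩ := hy
      refine ⟨S ∪ T, fun χ hχ => ?_⟩
      have h1 := hS χ fun m hm => hχ m (Finset.mem_union_left _ hm)
      have h2 := hT χ fun m hm => hχ m (Finset.mem_union_right _ hm)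
      rw [map_add, Submodule.coe_add, LinearMap.add_apply, h1, h2, add_zero]
  · rintro ⟨S, hS⟩
    let W := Submodule.span Fq (S : Set M)
    have : FiniteDimensional Fq W := FiniteDimensional.span_finset Fq S
    obtain ⟨p, hp⟩ := LinearMap.exists_leftInverse_of_injective W.subtype W.ker_subtype
    let b := Module.finBasis Fq W
    refine ⟨∑ i, f.1 (b.coord i ∘ₗ p) ⊗ₜ (b i : M), Subtype.ext (LinearMap.ext fun χ => ?_)⟩
    -- Replacing χ by its restriction to W, extended along the projection p, does not change it on
    -- S.
    have h1 : f.1 (χ - χ ∘ₗ W.subtype ∘ₗ p) = 0 := hS _ fun m hm => by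
      have : p m = ⟨m, Submodule.subset_span hm⟩ := LinearMap.congr_fun hp ⟨m, Submodule.subset_span hm⟩
      simp [this]
    have h2 : χ ∘ₗ W.subtype ∘ₗ p = ∑ i, χ (b i) • (b.coord i ∘ₗ p) := LinearMap.ext fun m => by
      have h := congrArg (χ ∘ₗ W.subtype) (b.sum_repr (p m))
      rw [map_sum] at h
      simp only [map_smul, LinearMap.comp_apply, Submodule.subtype_apply, smul_eq_mul] at h
      simp only [LinearMap.comp_apply, Submodule.subtype_apply, LinearMap.sum_apply,
        LinearMap.smul_apply, Module.Basis.coord_apply, smul_eq_mul, ← h, mul_comm]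
    rw [map_sub, sub_eq_zero] at h1
    rw [h1, h2]
    simp only [map_sum, map_smul, Submodule.coe_sum, LinearMap.sum_apply, ofTensor_tmul_apply]

variable {A : Type*} [CommRing A] [Algebra Fq A] [Module A M] [IsScalarTower Fq A M]

theorem tensorAction_add (g h : C ⊗[Fq] A) (f : CTensor Fq C M) :
    tensorAction Fq C M A (g + h) f = tensorAction Fq C M A g f + tensorAction Fq C M A h f :=
  map_add (tensorSMulHom f) g h

theorem tensorAction_sub (g h : C ⊗[Fq] A) (f : CTensor Fq C M) :
    tensorAction Fq C M A (g - h) f = tensorAction Fq C M A g f - tensorAction Fq C M A h f :=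
  map_sub (tensorSMulHom f) g h

theorem tensorAction_zero (f : CTensor Fq C M) : tensorAction Fq C M A 0 f = 0 :=
  map_zero (tensorSMulHom f)

theorem tensorAction_mul (g h : C ⊗[Fq] A) (f : CTensor Fq C M) :
    tensorAction Fq C M A (g * h) f = tensorAction Fq C M A g (tensorAction Fq C M A h f) := by
  induction g with
  | zero => rw [zero_mul, tensorAction_zero, tensorAction_zero]
  | add g₁ g₂ h₁ h₂ => rw [add_mul, tensorAction_add, tensorAction_add, h₁, h₂]
  | tmul c a =>
    induction h with
    | zero =>
      rw [mul_zero, tensorAction_zero]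
      exact Subtype.ext (LinearMap.ext fun χ => by simp [tensorAction_tmul])
    | add h₁ h₂ e₁ e₂ =>
      rw [mul_add, tensorAction_add, tensorAction_add, e₁, e₂]
      refine Subtype.ext (LinearMap.ext fun χ => ?_)
      simp only [tensorAction_tmul, Submodule.coe_add, LinearMap.add_apply, mul_add]
    | tmul d b =>
      refine Subtype.ext (LinearMap.ext fun χ => ?_)
      rw [Algebra.TensorProduct.tmul_mul_tmul, tensorAction_tmul, tensorAction_tmul,
        tensorAction_tmul, mul_assoc]
      congr 3
      ext m
      simp

theorem tensorAction_mem_range_ofTensor (h : C ⊗[Fq] A) {f : CTensor Fq C M}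
    (hf : f ∈ LinearMap.range (ofTensor Fq C M)) :
    tensorAction Fq C M A h f ∈ LinearMap.range (ofTensor Fq C M) := by
  classical
  induction h with
  | zero => rw [tensorAction_zero]; exact zero_mem _
  | add g h hg hh => rw [tensorAction_add]; exact add_mem hg hh
  | tmul c a =>
    obtain ⟨S, hS⟩ := (mem_range_ofTensor_iff f).1 hf
    refine (mem_range_ofTensor_iff _).2 ⟨S.image (a • ·), fun χ hχ => ?_⟩
    have h : f.1 (χ ∘ₗ Algebra.lsmul Fq Fq M a) = 0 :=
      hS _ fun m hm => hχ (a • m) (Finset.mem_image_of_mem _ hm)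
    rw [tensorAction_tmul, h, mul_zero]

theorem tensorAction_mem_range_of_mem_diagonalIdeal [Algebra A C] {f : CTensor Fq C M}
    (hf : ∀ a : A, tensorAction Fq C M A (algebraMap A C a ⊗ₜ[Fq] (1 : A) - (1 : C) ⊗ₜ[Fq] a) f ∈
      LinearMap.range (ofTensor Fq C M)) {h : C ⊗[Fq] A} (hh : h ∈ diagonalIdeal Fq C A) :
    tensorAction Fq C M A h f ∈ LinearMap.range (ofTensor Fq C M) := by
  refine Submodule.span_induction ?_ ?_ ?_ ?_ hh
  · rintro _ ⟨a, rfl⟩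
    exact hf a
  · rw [tensorAction_zero]; exact zero_mem _
  · intro x y _ _ hx hy
    rw [tensorAction_add]; exact add_mem hx hy
  · intro g x _ hx
    rw [smul_eq_mul, tensorAction_mul]
    exact tensorAction_mem_range_ofTensor g hx

end Finite

/-! ### The norm at infinity on `K` and `A` -/

section Norms

variable {Fq C : Type*} [Field Fq] [Fintype Fq] [NormedField C] [Algebra Fq C]

theorem norm_smul_eq {k : Fq} (hk : k ≠ 0) (c : C) : ‖k • c‖ = ‖c‖ := by
  refine le_antisymm (norm_smul_le' k c) ?_
  simpa [smul_smul, inv_mul_cancel₀ hk] using norm_smul_le' k⁻¹ (k • c)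

variable (Fq) in
theorem one_lt_card : (1 : ℝ) < Fintype.card Fq := by
  exact_mod_cast Fintype.one_lt_card

end Norms

theorem isScalarTower_const (Fq A K C : Type*) [CommSemiring Fq] [CommSemiring A] [CommSemiring K]
    [Semiring C] [Algebra Fq A] [Algebra Fq K] [Algebra Fq C] [Algebra A K] [Algebra A C]
    [Algebra K C] [IsScalarTower Fq A K] [IsScalarTower Fq A C] [IsScalarTower A K C] :
    IsScalarTower Fq K C :=
  IsScalarTower.of_algebraMap_eq fun x => by
    rw [IsScalarTower.algebraMap_apply Fq A C, IsScalarTower.algebraMap_apply Fq A K,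
      IsScalarTower.algebraMap_apply A K C]

/-! ### The residue field at infinity -/

section Place

variable {Fq K C : Type*} [Field Fq] [Fintype Fq] [Field K] [NormedField C] [CompleteSpace C]
  [Algebra K C] {O : ValuationSubring K}

theorem norm_lt_one_of_mem_nonunits (hC : IsCInfty Fq C O) {x : K} (hx : x ∈ O.nonunits) :
    ‖algebraMap K C x‖ < 1 := by
  rcases eq_or_ne x 0 with rfl | hx0
  · simp
  rw [ValuationSubring.mem_nonunits_iff] at hx
  have h : ¬ ‖algebraMap K C x⁻¹‖ ≤ 1 := by
    rw [hC.norm_le_one_iff, ← ValuationSubring.valuation_le_one_iff, map_inv₀, not_le]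
    exact (one_lt_inv₀ (zero_lt_iff.2 (by simpa using hx0))).2 hx
  rw [map_inv₀, norm_inv, not_le] at h
  exact (one_lt_inv₀ (norm_pos_iff.2 (by simpa using hx0))).1 h

variable [Algebra Fq K] [Algebra Fq C] [IsScalarTower Fq K C]

/-- The residue field at ∞ is `Fq`, so x / y is congruent to a constant modulo the maximal ideal. -/
theorem exists_norm_sub_smul_lt {A : Type*} [CommRing A] [Algebra A K]
    (hA : IsRingOfFunctionsAwayFrom Fq A O) (hC : IsCInfty Fq C O)
    {x y : K} (hy : y ≠ 0) (h : ‖algebraMap K C x‖ ≤ ‖algebraMap K C y‖) :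
    ∃ c : Fq, ‖algebraMap K C x - c • algebraMap K C y‖ < ‖algebraMap K C y‖ := by
  have hy' : 0 < ‖algebraMap K C y‖ := norm_pos_iff.2 (by simpa using hy)
  have hO : x / y ∈ O := by
    rw [← hC.norm_le_one_iff, map_div₀, norm_div]
    exact (div_le_one hy').2 h
  obtain ⟨c, hc⟩ := hA.degree_one _ hO
  refine ⟨c, ?_⟩
  have h1 := norm_lt_one_of_mem_nonunits hC hc
  have h2 : algebraMap K C x - c • algebraMap K C y =
      algebraMap K C (x / y - algebraMap Fq K c) * algebraMap K C y := by
    rw [Algebra.smul_def, IsScalarTower.algebraMap_apply Fq K C, ← map_mul, ← map_mul, ← map_sub,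
      sub_mul, div_mul_cancel₀ _ hy]
  rw [h2, norm_mul]
  exact mul_lt_of_lt_one_left hy' h1

end Place

/-- Applied to the set of degrees of elements of A, with D the degree of t. Each residue class mod D
meeting S is contained in S from its least element in S onwards; M exceeds all these least elements,
and the summand D keeps n - D a true subtraction. -/
theorem exists_forall_sub_mem_of_forall_add_mem {S : Set ℕ} {D : ℕ} (hD : 0 < D)
    (hS : ∀ n ∈ S, n + D ∈ S) : ∃ M, D ≤ M ∧ ∀ n ∈ S, M < n → n - D ∈ S := by
  classical
  let m : ℕ → ℕ := fun i => if h : ∃ n ∈ S, n % D = i then Nat.find h else 0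
  refine ⟨D + ∑ i ∈ Finset.range D, m i, Nat.le_add_right _ _, fun n hn hlt => ?_⟩
  have hex : ∃ k ∈ S, k % D = n % D := ⟨n, hn, rfl⟩
  have hm : m (n % D) = Nat.find hex := dif_pos hex
  have hle : m (n % D) ≤ ∑ i ∈ Finset.range D, m i :=
    Finset.single_le_sum (f := m) (fun _ _ => Nat.zero_le _)
      (Finset.mem_range.2 (Nat.mod_lt _ hD))
  obtain ⟨hk1, hk2⟩ := Nat.find_spec hex
  set k := Nat.find hex
  have hadd : ∀ i, k + D * i ∈ S := fun i => by
    induction i with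
    | zero => simpa using hk1
    | succ i ih => have := hS _ ih; rwa [mul_add, mul_one, ← add_assoc]
  obtain ⟨i, hi⟩ : D ∣ n - k := (Nat.modEq_iff_dvd' (by omega)).1 hk2
  rcases i with _ | i
  · omega
  · convert hadd i using 1
    rw [mul_add] at hi
    omega

/-! ### Functions regular away from infinity -/

section Curve

variable {Fq A K C : Type*} [Field Fq] [Fintype Fq] [CommRing A] [Field K] [NormedField C]
  [Algebra Fq A] [Algebra Fq K] [Algebra Fq C] [Algebra A K] [Algebra A C] [Algebra K C]
  [IsScalarTower Fq A K] [IsScalarTower Fq A C] [IsScalarTower A K C]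
  {O : ValuationSubring K} [CompleteSpace C]

/-- A function without poles is constant. Subtracting its value at ∞ leaves y in every valuation
ring over `Fq`, hence integral over `Fq`, so the powers of y form a finite set. Since ‖y‖ < 1, the
norms of these powers would decrease strictly if y were nonzero. -/
theorem exists_algebraMap_eq_of_norm_le_one [FaithfulSMul A K]
    (hA : IsRingOfFunctionsAwayFrom Fq A O) (hC : IsCInfty Fq C O) {a : A}
    (ha : ‖algebraMap A C a‖ ≤ 1) : ∃ c : Fq, a = algebraMap Fq A c := by
  have htower := isScalarTower_const Fq A K C
  have haO : algebraMap A K a ∈ O := by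
    rw [← hC.norm_le_one_iff, ← IsScalarTower.algebraMap_apply A K C]; exact ha
  obtain ⟨c, hc⟩ := hA.degree_one _ haO
  refine ⟨c, ?_⟩
  set y := algebraMap A K a - algebraMap Fq K c with hy
  by_contra hne
  have hy0 : y ≠ 0 := fun h => hne <| FaithfulSMul.algebraMap_injective A K <| by
    rw [← IsScalarTower.algebraMap_apply, ← sub_eq_zero, ← hy, h]
  have hyV : ∀ V : ValuationSubring K, (∀ c : Fq, algebraMap Fq K c ∈ V) → y ∈ V := by
    intro V hV
    refine sub_mem ?_ (hV c)
    rcases eq_or_ne V O with rfl | hVO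
    · exact haO
    · exact (hA.mem_range_iff _).1 ⟨a, rfl⟩ V hV hVO
  have hint : y ∈ (integralClosure (Subring.closure (Set.range (algebraMap Fq K))) K).toSubring := by
    rw [← iInf_valuationSubring_superset, Subring.mem_iInf]
    rintro ⟨V, hV⟩
    exact hyV V fun c => hV ⟨c, rfl⟩
  have hcl : Subring.closure (Set.range (algebraMap Fq K)) = (algebraMap Fq K).range := by
    rw [← RingHom.coe_range, Subring.closure_eq]
  have hint' : IsIntegral Fq y := by
    rw [hcl] at hint
    obtain ⟨p, hp, hp0⟩ := hint
    obtain ⟨p', hp', hp''⟩ : ∃ p' : Polynomial Fq, p'.map (algebraMap Fq K).rangeRestrict = p ∧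
        p'.Monic := by
      have hl : p ∈ Polynomial.lifts (algebraMap Fq K).rangeRestrict := by
        rw [Polynomial.lifts_iff_coeff_lifts]
        intro n
        exact (algebraMap Fq K).rangeRestrict_surjective _
      obtain ⟨p', h1, _, h3⟩ := Polynomial.lifts_and_natDegree_eq_and_monic hl hp
      exact ⟨p', h1, h3⟩
    refine ⟨p', hp'', ?_⟩
    rw [← hp', Polynomial.eval₂_map] at hp0
    exact hp0
  have hlt := norm_lt_one_of_mem_nonunits hC hc
  have hfin : (Algebra.adjoin Fq {y} : Set K).Finite := by
    have : Module.Finite Fq (Algebra.adjoin Fq {y}) := ⟨by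
      exact (Submodule.fg_top _).2 hint'.fg_adjoin_singleton⟩
    have : Finite (Algebra.adjoin Fq {y}) := Module.finite_of_finite Fq
    exact Set.toFinite _
  obtain ⟨m, n, hmn, h⟩ := Set.Finite.exists_lt_map_eq_of_forall_mem (f := fun n : ℕ => y ^ n)
    (fun n => pow_mem (Algebra.self_mem_adjoin_singleton Fq y) n) hfin
  have h' := congrArg (fun z => ‖algebraMap K C z‖) h
  simp only [map_pow, norm_pow] at h'
  exact (pow_lt_pow_right_of_lt_one₀ (norm_pos_iff.2 (by simpa using hy0)) hlt hmn).ne' h'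

variable [FaithfulSMul A K]

theorem one_le_norm_of_ne_zero (hA : IsRingOfFunctionsAwayFrom Fq A O) (hC : IsCInfty Fq C O)
    {a : A} (ha : a ≠ 0) : 1 ≤ ‖algebraMap A C a‖ := by
  by_contra! h
  obtain ⟨c, rfl⟩ := exists_algebraMap_eq_of_norm_le_one (K := K) hA hC h.le
  have hc : c ≠ 0 := by rintro rfl; simp at ha
  rw [← IsScalarTower.algebraMap_apply Fq A C, Algebra.algebraMap_eq_smul_one, norm_smul_eq hc,
    norm_one] at h
  exact h.false

theorem exists_norm_eq_pow (hA : IsRingOfFunctionsAwayFrom Fq A O) (hC : IsCInfty Fq C O)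
    {a : A} (ha : a ≠ 0) : ∃ n : ℕ, ‖algebraMap A C a‖ = (Fintype.card Fq : ℝ) ^ n := by
  obtain ⟨n, hn⟩ := hC.norm_eq_zpow (algebraMap A K a)
    (by simpa using (FaithfulSMul.algebraMap_injective A K).ne ha)
  rw [← IsScalarTower.algebraMap_apply A K C] at hn
  have h := one_le_norm_of_ne_zero (K := K) hA hC ha
  rw [hn, one_le_zpow_iff_right₀ (one_lt_card Fq)] at h
  lift n to ℕ using h
  exact ⟨n, by simpa using hn⟩

theorem exists_norm_sub_smul_lt_ring (hA : IsRingOfFunctionsAwayFrom Fq A O)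
    (hC : IsCInfty Fq C O) {a b : A} (hb : b ≠ 0)
    (h : ‖algebraMap A C a‖ ≤ ‖algebraMap A C b‖) :
    ∃ c : Fq, ‖algebraMap A C (a - c • b)‖ < ‖algebraMap A C b‖ := by
  have htower := isScalarTower_const Fq A K C
  rw [IsScalarTower.algebraMap_apply A K C, IsScalarTower.algebraMap_apply A K C b] at h
  obtain ⟨c, hc⟩ := exists_norm_sub_smul_lt hA hC
    (by simpa using (FaithfulSMul.algebraMap_injective A K).ne hb) h
  refine ⟨c, ?_⟩
  rw [← IsScalarTower.algebraMap_apply A K C, ← IsScalarTower.algebraMap_apply A K C] at hc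
  rwa [map_sub, Algebra.smul_def, map_mul, ← IsScalarTower.algebraMap_apply Fq A C,
    ← Algebra.smul_def]

/-- Raising the bound by one degree adds at most one dimension over `Fq`: a constant multiple of a
single element b of top norm cancels any leading term. -/
theorem finite_norm_le_pow (hA : IsRingOfFunctionsAwayFrom Fq A O) (hC : IsCInfty Fq C O)
    (n : ℕ) : {a : A | ‖algebraMap A C a‖ ≤ (Fintype.card Fq : ℝ) ^ n}.Finite := by
  induction n with
  | zero =>
    refine (Set.finite_range (algebraMap Fq A)).subset fun a ha => ?_
    obtain ⟨c, hc⟩ := exists_algebraMap_eq_of_norm_le_one (K := K) hA hC (a := a) (by simpa using ha)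
    exact ⟨c, hc.symm⟩
  | succ n ih =>
    by_cases hex : ∃ b : A, ‖algebraMap A C b‖ = (Fintype.card Fq : ℝ) ^ (n + 1)
    · obtain ⟨b, hb⟩ := hex
      have hq := one_lt_card Fq
      have hb0 : b ≠ 0 := by
        rintro rfl
        have : (0 : ℝ) < (Fintype.card Fq : ℝ) ^ (n + 1) := by positivity
        rw [← hb, map_zero, norm_zero] at this
        exact this.false
      refine ((Set.finite_univ (α := Fq)).prod ih |>.image fun x => x.1 • b + x.2).subset
        fun a ha => ?_
      obtain ⟨c, hc⟩ := exists_norm_sub_smul_lt_ring (K := K) hA hC hb0 (ha.trans_eq hb.symm)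
      refine ⟨(c, a - c • b), ⟨trivial, ?_⟩, by simp⟩
      rcases eq_or_ne (a - c • b) 0 with h0 | h0
      · simp [h0]
      · obtain ⟨m, hm⟩ := exists_norm_eq_pow (K := K) hA hC h0
        rw [hm, hb, pow_lt_pow_iff_right₀ hq] at hc
        simp only [Set.mem_ofPred_eq]
        rw [hm, pow_le_pow_iff_right₀ hq]
        omega
    · refine ih.subset fun a ha => ?_
      have ha : ‖algebraMap A C a‖ ≤ (Fintype.card Fq : ℝ) ^ (n + 1) := ha
      have hq := one_lt_card Fq
      rcases eq_or_ne a 0 with rfl | h0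
      · simp
      obtain ⟨m, hm⟩ := exists_norm_eq_pow (K := K) hA hC h0
      have hmn : m ≠ n + 1 := by rintro rfl; exact hex ⟨a, hm⟩
      simp only [Set.mem_ofPred_eq]
      rw [hm, pow_le_pow_iff_right₀ hq] at ha ⊢
      omega

theorem finite_norm_le (hA : IsRingOfFunctionsAwayFrom Fq A O) (hC : IsCInfty Fq C O)
    (R : ℝ) : {a : A | ‖algebraMap A C a‖ ≤ R}.Finite := by
  obtain ⟨n, hn⟩ := pow_unbounded_of_one_lt R (one_lt_card Fq)
  exact (finite_norm_le_pow (K := K) hA hC n).subset fun a ha => le_trans ha hn.le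

/-- Otherwise A, and with it K, would consist of constants, and O would be trivial. -/
theorem exists_one_lt_norm [IsFractionRing A K] (hA : IsRingOfFunctionsAwayFrom Fq A O)
    (hC : IsCInfty Fq C O) : ∃ t : A, 1 < ‖algebraMap A C t‖ := by
  by_contra! h
  refine hA.ne_top (eq_top_iff.2 fun x _ => ?_)
  obtain ⟨a, b, _, rfl⟩ := IsFractionRing.div_surjective (A := A) x
  obtain ⟨c, rfl⟩ := exists_algebraMap_eq_of_norm_le_one (K := K) hA hC (h a)
  obtain ⟨d, rfl⟩ := exists_algebraMap_eq_of_norm_le_one (K := K) hA hC (h b)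
  rw [← IsScalarTower.algebraMap_apply, ← IsScalarTower.algebraMap_apply, ← map_div₀]
  exact hA.algebraMap_mem _

/-- Division with remainder by a nonconstant function `t`: the remainders are bounded. -/
theorem exists_division [IsUltrametricDist C] (hA : IsRingOfFunctionsAwayFrom Fq A O)
    (hC : IsCInfty Fq C O) {t : A} (ht : 1 < ‖algebraMap A C t‖) : ∃ R : ℝ, ∀ a : A, ∃ s a' : A, a = s + t * a' ∧
      ‖algebraMap A C s‖ ≤ R ∧ (R < ‖algebraMap A C a‖ → ‖algebraMap A C a'‖ < ‖algebraMap A C a‖) := by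
  have hq := one_lt_card Fq
  have ht0 : t ≠ 0 := by rintro rfl; simp at ht; linarith
  obtain ⟨D, hD⟩ := exists_norm_eq_pow (K := K) hA hC ht0
  have hD0 : 0 < D := by
    rcases Nat.eq_zero_or_pos D with rfl | h
    · simp [hD] at ht
    · exact h
  obtain ⟨M, hDM, hM⟩ := exists_forall_sub_mem_of_forall_add_mem hD0
    (S := {n | ∃ a : A, ‖algebraMap A C a‖ = (Fintype.card Fq : ℝ) ^ n}) (by
      rintro n ⟨a, ha⟩
      exact ⟨a * t, by rw [map_mul, norm_mul, ha, hD, pow_add]⟩)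
  have hq0 : (0 : ℝ) < Fintype.card Fq := by linarith
  -- Induction on the degree. Above degree M every degree that occurs is also the degree of some t *
  -- b, so the leading term can be cancelled by a constant multiple of t * b.
  have key : ∀ n : ℕ, ∀ a : A, ‖algebraMap A C a‖ ≤ (Fintype.card Fq : ℝ) ^ n →
      ∃ s a' : A, a = s + t * a' ∧ ‖algebraMap A C s‖ ≤ (Fintype.card Fq : ℝ) ^ M ∧
        ‖algebraMap A C s‖ ≤ ‖algebraMap A C a‖ := by
    intro n
    induction n with
    | zero => exact fun a ha => ⟨a, 0, by simp, ha.trans (pow_le_pow_right₀ hq.le (Nat.zero_le _)), le_rfl⟩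
    | succ n ih =>
      intro a ha
      rcases le_or_gt ‖algebraMap A C a‖ ((Fintype.card Fq : ℝ) ^ M) with hle | hgt
      · exact ⟨a, 0, by simp, hle, le_rfl⟩
      have ha0 : a ≠ 0 := by
        rintro rfl
        rw [map_zero, norm_zero] at hgt
        exact absurd hgt (not_lt.2 (by positivity))
      obtain ⟨m, hm⟩ := exists_norm_eq_pow (K := K) hA hC ha0
      rw [hm] at ha hgt
      rw [pow_lt_pow_iff_right₀ hq] at hgt
      rw [pow_le_pow_iff_right₀ hq] at ha
      obtain ⟨b, hb⟩ := hM m ⟨a, hm⟩ hgt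
      have htb : ‖algebraMap A C (t * b)‖ = (Fintype.card Fq : ℝ) ^ m := by
        rw [map_mul, norm_mul, hb, hD, ← pow_add]
        congr 1
        omega
      have htb0 : t * b ≠ 0 := by
        intro h0
        rw [h0, map_zero, norm_zero] at htb
        exact absurd htb (by positivity)
      obtain ⟨c, hc⟩ := exists_norm_sub_smul_lt_ring (K := K) hA hC htb0 (hm.trans htb.symm).le
      rw [htb] at hc
      have hc' : ‖algebraMap A C (a - c • (t * b))‖ ≤ (Fintype.card Fq : ℝ) ^ n := by
        rcases eq_or_ne (a - c • (t * b)) 0 with h0 | h0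
        · rw [h0, map_zero, norm_zero]; positivity
        · obtain ⟨k, hk⟩ := exists_norm_eq_pow (K := K) hA hC h0
          rw [hk, pow_lt_pow_iff_right₀ hq] at hc
          rw [hk, pow_le_pow_iff_right₀ hq]
          omega
      obtain ⟨s, a', h1, h2, h3⟩ := ih _ hc'
      refine ⟨s, c • b + a', ?_, h2, h3.trans (hc.le.trans hm.ge)⟩
      rw [mul_add, mul_smul_comm, add_left_comm, ← h1, add_sub_cancel]
  refine ⟨(Fintype.card Fq : ℝ) ^ M, fun a => ?_⟩
  obtain ⟨n, hn⟩ := pow_unbounded_of_one_lt ‖algebraMap A C a‖ hq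
  obtain ⟨s, a', h1, h2, h3⟩ := key n a hn.le
  refine ⟨s, a', h1, h2, fun hlt => ?_⟩
  -- As ‖s‖ ≤ ‖a‖, the product t * a' = a - s is no larger than a, and ‖t‖ > 1 then makes a'
  -- strictly smaller.
  have h4 : ‖algebraMap A C t‖ * ‖algebraMap A C a'‖ ≤ ‖algebraMap A C a‖ := by
    rw [← norm_mul, ← map_mul, ← sub_eq_iff_eq_add'.2 h1, map_sub]
    exact norm_sub_le_of_le le_rfl h3
  have ha : 0 < ‖algebraMap A C a‖ := lt_trans (by positivity) hlt
  by_contra! h5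
  nlinarith

/-! ### Finiteness of `A` and of its differentials -/

/-- Repeated division by t shows that t and the finitely many possible remainders generate A. -/
theorem finiteType_ring [IsFractionRing A K] [IsUltrametricDist C]
    (hA : IsRingOfFunctionsAwayFrom Fq A O) (hC : IsCInfty Fq C O) : Algebra.FiniteType Fq A := by
  classical
  obtain ⟨t, ht⟩ := exists_one_lt_norm (K := K) hA hC
  obtain ⟨R, hR⟩ := exists_division (K := K) hA hC ht
  have hfin := finite_norm_le (K := K) hA hC R
  refine ⟨⟨insert t hfin.toFinset, eq_top_iff.2 fun a _ => ?_⟩⟩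
  set B := Algebra.adjoin Fq ((insert t hfin.toFinset : Finset A) : Set A)
  have hball : ∀ s : A, ‖algebraMap A C s‖ ≤ R → s ∈ B := fun s hs =>
    Algebra.subset_adjoin (by simp [hs])
  have htB : t ∈ B := Algebra.subset_adjoin (by simp)
  have key : ∀ n : ℕ, ∀ a : A, ‖algebraMap A C a‖ ≤ (Fintype.card Fq : ℝ) ^ n → a ∈ B := by
    intro n
    induction n with
    | zero =>
      intro a ha
      obtain ⟨c, rfl⟩ := exists_algebraMap_eq_of_norm_le_one (K := K) hA hC (by simpa using ha)
      exact B.algebraMap_mem c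
    | succ n ih =>
      intro a ha
      rcases le_or_gt ‖algebraMap A C a‖ R with hle | hgt
      · exact hball a hle
      obtain ⟨s, a', h1, h2, h3⟩ := hR a
      rw [h1]
      refine add_mem (hball s h2) (mul_mem htB ?_)
      rcases eq_or_ne a' 0 with rfl | h0
      · exact zero_mem _
      refine ih a' ?_
      obtain ⟨k, hk⟩ := exists_norm_eq_pow (K := K) hA hC h0
      have := (h3 hgt).trans_le ha
      rw [hk, pow_lt_pow_iff_right₀ (one_lt_card Fq)] at this
      rw [hk, pow_le_pow_iff_right₀ (one_lt_card Fq)]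
      omega
  obtain ⟨n, hn⟩ := pow_unbounded_of_one_lt ‖algebraMap A C a‖ (one_lt_card Fq)
  exact key n a hn.le

/-- For a cyclic module killed by a, division with remainder reduces every coefficient to one of
finitely many; finite sums of such modules stay finite. -/
theorem finite_of_fg_of_torsion [IsFractionRing A K] [IsUltrametricDist C] [IsDomain A]
    (hA : IsRingOfFunctionsAwayFrom Fq A O) (hC : IsCInfty Fq C O)
    {M : Type*} [AddCommGroup M] [Module A M] {N : Submodule A M} (hN : N.FG)
    (htors : ∀ x ∈ N, ∃ a : A, a ≠ 0 ∧ a • x = 0) : (N : Set M).Finite := by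
  induction N, hN using Submodule.fg_induction with
  | singleton x =>
    obtain ⟨t, ht⟩ := exists_one_lt_norm (K := K) hA hC
    obtain ⟨a, ha0, ha⟩ := htors x (Submodule.mem_span_singleton_self x)
    -- Division requires a nonconstant divisor, and a may be constant, so t * a is used instead.
    have hta : 1 < ‖algebraMap A C (t * a)‖ := by
      rw [map_mul, norm_mul]
      have := one_le_norm_of_ne_zero (K := K) hA hC ha0
      nlinarith
    obtain ⟨R, hR⟩ := exists_division (K := K) hA hC hta
    refine ((finite_norm_le (K := K) hA hC R).image fun s => s • x).subset fun y hy => ?_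
    obtain ⟨b, rfl⟩ := Submodule.mem_span_singleton.1 hy
    obtain ⟨s, a', h1, h2, -⟩ := hR b
    refine ⟨s, h2, ?_⟩
    rw [h1, add_smul, mul_right_comm, mul_smul _ a, ha, smul_zero, add_zero]
  | sup N₁ N₂ _ _ h₁ h₂ =>
    rw [Submodule.coe_sup]
    exact (h₁ fun x hx => htors x (Submodule.mem_sup_left hx)).add
      (h₂ fun x hx => htors x (Submodule.mem_sup_right hx))

/-- A common denominator d puts d * g(M) inside A, so finitely many values of g have norm at most R.
The nonempty fibres are cosets of the kernel, which is finitely generated and torsion, hence finite.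
-/
theorem finite_norm_le_of_fg [IsFractionRing A K] [IsUltrametricDist C] [IsDomain A]
    (hA : IsRingOfFunctionsAwayFrom Fq A O) (hC : IsCInfty Fq C O)
    {M : Type*} [AddCommGroup M] [Module A M] [Module.Finite A M] (g : M →ₗ[A] K)
    (htors : ∀ x, g x = 0 → ∃ a : A, a ≠ 0 ∧ a • x = 0) (R : ℝ) :
    {x : M | ‖algebraMap K C (g x)‖ ≤ R}.Finite := by
  classical
  have hft := finiteType_ring (K := K) hA hC
  have : IsNoetherianRing A := Algebra.FiniteType.isNoetherianRing Fq A
  have hker : (LinearMap.ker g : Set M).Finite := finite_of_fg_of_torsion (K := K) hA hC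
    (IsNoetherian.noetherian _) htors
  obtain ⟨S, hS⟩ := Module.Finite.fg_top (R := A) (M := M)
  obtain ⟨d, hd⟩ := IsLocalization.exist_integer_multiples (nonZeroDivisors A) S g
  have hd0 : algebraMap A K d ≠ 0 := IsFractionRing.to_map_ne_zero_of_mem_nonZeroDivisors d.2
  have hint : ∀ x : M, ∃ a : A, algebraMap A K a = algebraMap A K d * g x := by
    intro x
    have hx : x ∈ Submodule.span A (S : Set M) := hS ▸ Submodule.mem_top
    induction hx using Submodule.span_induction with
    | mem x hx =>
      obtain ⟨a, ha⟩ := hd x hx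
      exact ⟨a, by rw [ha, Algebra.smul_def]⟩
    | zero => exact ⟨0, by simp⟩
    | add x y _ _ hx hy =>
      obtain ⟨a, ha⟩ := hx
      obtain ⟨b, hb⟩ := hy
      exact ⟨a + b, by rw [map_add, ha, hb, map_add, mul_add]⟩
    | smul c x _ hx =>
      obtain ⟨a, ha⟩ := hx
      exact ⟨c * a, by rw [map_mul, ha, map_smul, Algebra.smul_def]; ring⟩
  have hfinK : {y : K | y ∈ Set.range g ∧ ‖algebraMap K C y‖ ≤ R}.Finite := by
    refine ((finite_norm_le (K := K) hA hC (‖algebraMap A C d‖ * R)).image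
      fun a => (algebraMap A K d)⁻¹ * algebraMap A K a).subset ?_
    rintro _ ⟨⟨x, rfl⟩, hx⟩
    obtain ⟨a, ha⟩ := hint x
    refine ⟨a, ?_, ?_⟩
    · have h : algebraMap A C a = algebraMap A C d * algebraMap K C (g x) := by
        rw [IsScalarTower.algebraMap_apply A K C, ha, map_mul, ← IsScalarTower.algebraMap_apply]
      simp only [Set.mem_ofPred_eq]
      rw [h, norm_mul]
      exact mul_le_mul_of_nonneg_left hx (norm_nonneg _)
    · change (algebraMap A K d)⁻¹ * algebraMap A K a = g x
      rw [ha, inv_mul_cancel_left₀ hd0]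
  refine (hfinK.preimage' (f := g) ?_).subset fun x hx => ⟨⟨x, rfl⟩, hx⟩
  rintro _ ⟨⟨x, rfl⟩, -⟩
  refine (hker.image fun y => y + x).subset fun y hy => ⟨y - x, ?_, by simp⟩
  have hy : g y = g x := hy
  simp [hy]

/-- `t ⊗ 1 - 1 ⊗ t` is a nonzerodivisor of `C ⊗ A` if `t` is not constant. -/
theorem diagonal_mem_nonZeroDivisors [IsDomain A]
    (hA : IsRingOfFunctionsAwayFrom Fq A O) (hC : IsCInfty Fq C O) {t : A}
    (ht : 1 < ‖algebraMap A C t‖) :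
    algebraMap A C t ⊗ₜ[Fq] (1 : A) - (1 : C) ⊗ₜ[Fq] t ∈ nonZeroDivisors (C ⊗[Fq] A) := by
  classical
  have ht0 : algebraMap A C t ≠ 0 := fun h => by rw [h, norm_zero] at ht; linarith
  rw [mem_nonZeroDivisors_iff_right]
  intro x hx
  -- An annihilated x satisfies (t^k ⊗ 1) x = (1 ⊗ t^k) x for all k. Its left side lies in C ⊗ W
  -- with W finite-dimensional, its right side in C ⊗ t^k W. For large k these meet in zero; the
  -- projection p, the identity on W and zero on t^k W, makes this explicit.
  obtain ⟨W, hW, hxW⟩ := TensorProduct.exists_finite_submodule_right_of_setFinite {x}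
    (Set.finite_singleton x)
  obtain ⟨y, rfl⟩ := hxW rfl
  have : Finite W := Module.finite_of_finite Fq
  obtain ⟨B, hB⟩ := (Set.toFinite (Set.range fun w : W => ‖algebraMap A C w‖)).bddAbove
  -- Nonzero elements of A have norm at least 1, so nonzero elements of t^k W have norm above B, the
  -- bound on W.
  obtain ⟨k, hk⟩ := pow_unbounded_of_one_lt B ht
  have hdisj : Disjoint W (W.map (LinearMap.mulLeft Fq (t ^ k))) := by
    rw [Submodule.disjoint_def]
    rintro _ hw ⟨w, -, rfl⟩
    by_contra hne
    have hw0 : w ≠ 0 := by rintro rfl; simp at hne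
    have h1 := hB ⟨⟨_, hw⟩, rfl⟩
    have h2 := one_le_norm_of_ne_zero (K := K) hA hC hw0
    simp only [LinearMap.mulLeft_apply, map_mul, map_pow, norm_mul, norm_pow] at h1
    have h3 : 0 ≤ ‖algebraMap A C t‖ ^ k := by positivity
    nlinarith
  obtain ⟨U, hU, hcompl⟩ := hdisj.exists_isCompl
  let p : A →ₗ[Fq] A := U.subtype ∘ₗ Submodule.projectionOnto U _ hcompl
  have hp1 : p ∘ₗ W.subtype = W.subtype := LinearMap.ext fun w => by
    have := Submodule.projectionOnto_apply_left hcompl ⟨w, hU w.2⟩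
    simpa [p] using congrArg Subtype.val this
  have hp2 : p ∘ₗ LinearMap.mulLeft Fq (t ^ k) ∘ₗ W.subtype = 0 := LinearMap.ext fun w => by
    have := Submodule.projectionOnto_apply_of_mem_right hcompl
      (x := LinearMap.mulLeft Fq (t ^ k) w) ⟨w, w.2, rfl⟩
    simpa [p] using this
  have hpow : ∀ z : C ⊗[Fq] A,
      z * (algebraMap A C t ⊗ₜ[Fq] (1 : A) - (1 : C) ⊗ₜ[Fq] t) = 0 → ∀ n : ℕ,
      (algebraMap A C t ^ n) ⊗ₜ[Fq] (1 : A) * z = (1 : C) ⊗ₜ[Fq] (t ^ n) * z := by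
    intro z hz n
    rw [mul_sub, sub_eq_zero, mul_comm z, mul_comm z] at hz
    induction n with
    | zero => simp
    | succ n ih =>
      have h1 : (algebraMap A C t ^ (n + 1)) ⊗ₜ[Fq] (1 : A) =
          (algebraMap A C t ⊗ₜ[Fq] (1 : A)) * (algebraMap A C t ^ n) ⊗ₜ[Fq] (1 : A) := by
        rw [Algebra.TensorProduct.tmul_mul_tmul, pow_succ', one_mul]
      have h2 : (1 : C) ⊗ₜ[Fq] (t ^ (n + 1)) = ((1 : C) ⊗ₜ[Fq] (t ^ n)) * (1 : C) ⊗ₜ[Fq] t := by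
        rw [Algebra.TensorProduct.tmul_mul_tmul, pow_succ, one_mul]
      rw [h1, h2, mul_assoc, ih, mul_left_comm, hz, mul_assoc]
  have hleft : ∀ (c : C) (z : C ⊗[Fq] A),
      p.lTensor C (c ⊗ₜ[Fq] (1 : A) * z) = c ⊗ₜ[Fq] (1 : A) * p.lTensor C z := by
    intro c z
    induction z with
    | zero => simp
    | add z₁ z₂ h₁ h₂ => rw [mul_add, map_add, h₁, h₂, map_add, mul_add]
    | tmul d a => simp
  have hright : ∀ (a : A) (z : C ⊗[Fq] W), (1 : C) ⊗ₜ[Fq] a * W.subtype.lTensor C z =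
      (LinearMap.mulLeft Fq a ∘ₗ W.subtype).lTensor C z := by
    intro a z
    induction z with
    | zero => simp
    | add z₁ z₂ h₁ h₂ => rw [map_add, mul_add, h₁, h₂, map_add]
    | tmul d w => simp
  have h := congrArg (p.lTensor C) (hpow _ hx k)
  rw [hleft, hright, ← LinearMap.lTensor_comp_apply, ← LinearMap.lTensor_comp_apply, hp1, hp2,
    LinearMap.lTensor_zero, LinearMap.zero_apply] at h
  have h' := congrArg (((algebraMap A C t ^ k)⁻¹ ⊗ₜ[Fq] (1 : A)) * ·) h
  simp only [← mul_assoc, Algebra.TensorProduct.tmul_mul_tmul, mul_one, mul_zero] at h'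
  rwa [inv_mul_cancel₀ (pow_ne_zero _ ht0), ← Algebra.TensorProduct.one_def, one_mul] at h'

end Curve

/-! ### Differentials of the function field -/

section Differentials

open scoped IntermediateField

variable {k K : Type*} [Field k] [Field K] [Algebra k K]

/-- In characteristic `p`, a function field `K` in one variable over a perfect field is generated
over its subfield of `p`-th powers by any element which is not a `p`-th power. -/
theorem adjoin_fieldRange_frobenius_eq_top [PerfectField k] (p : ℕ) [Fact p.Prime] [CharP K p]
    (hfg : (⊤ : IntermediateField k K).FG) (htr : Algebra.trdeg k K = 1) {π : K}
    (hπ : ∀ c : K, c ^ p ≠ π) :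
    IntermediateField.adjoin (frobenius K p).fieldRange {π} = ⊤ := by
  have hp : p.Prime := Fact.out
  have : CharP k p := (RingHom.charP_iff (algebraMap k K) (algebraMap k K).injective p).2 ‹_›
  have : Algebra.EssFiniteType k K := by
    have := IntermediateField.essFiniteType_iff.2 hfg
    exact Algebra.EssFiniteType.of_surjective (IntermediateField.topEquiv (F := k) (E := K)).toAlgHom
      IntermediateField.topEquiv.surjective
  obtain ⟨s, hs, hsep⟩ := exists_isTranscendenceBasis_and_isSeparable_of_perfectField k K
  have hcard := hs.cardinalMk_eq_trdeg
  rw [htr, Cardinal.mk_coe_finset, Nat.cast_eq_one, Finset.card_eq_one] at hcard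
  obtain ⟨t, rfl⟩ := hcard
  set E := (frobenius K p).fieldRange with hE
  have hpow : ∀ x : K, x ^ p ∈ E := fun x => ⟨x, rfl⟩
  -- K is separable over k(t), so x ∈ k(t)(x^p); as k is perfect, k lies in K^p, and hence x ∈
  -- K^p(t).
  have ht : E⟮t⟯ = ⊤ := by
    refine eq_top_iff.2 fun x htop => ?_
    have hx : x ∈ IntermediateField.adjoin (IntermediateField.adjoin k (({t} : Finset K) : Set K)) {x ^ p} := by
      have := IntermediateField.adjoin_simple_eq_adjoin_pow_expChar_of_isSeparable
        (IntermediateField.adjoin k (({t} : Finset K) : Set K)) K (a := x)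
        (Algebra.IsSeparable.isSeparable _ x) p
      rw [← this]
      exact IntermediateField.mem_adjoin_simple_self _ x
    have hEt : ∀ y ∈ E, y ∈ E⟮t⟯ := fun y hy => (E⟮t⟯).algebraMap_mem ⟨y, hy⟩
    generalize hxp : x ^ p = z at hx
    have hz : z ∈ E := hxp ▸ hpow x
    clear hxp htop
    induction hx using IntermediateField.adjoin_induction with
    | mem y hy => rw [Set.mem_singleton_iff.1 hy]; exact hEt _ hz
    | algebraMap y =>
      obtain ⟨y, hy⟩ := y
      change y ∈ _
      induction hy using IntermediateField.adjoin_induction with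
      | mem y hy =>
        rw [show y = t by simpa using hy]
        exact IntermediateField.mem_adjoin_simple_self _ t
      | algebraMap c =>
        obtain ⟨d, rfl⟩ := surjective_frobenius k p c
        refine hEt _ ⟨algebraMap k K d, ?_⟩
        simp [frobenius_def]
      | add _ _ _ _ hx hy => exact add_mem hx hy
      | inv _ _ hx => exact inv_mem hx
      | mul _ _ _ _ hx hy => exact mul_mem hx hy
    | add _ _ _ _ hx hy => exact add_mem hx hy
    | inv _ _ hx => exact inv_mem hx
    | mul _ _ _ _ hx hy => exact mul_mem hx hy
  have hroot : ∀ x : K, Polynomial.aeval x (Polynomial.X ^ p - Polynomial.C (⟨x ^ p, hpow x⟩ : E)) = 0 :=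
    fun x => by
      simp [Algebra.algebraMap_ofSubsemiring_apply]
  have hint : ∀ x : K, IsIntegral E x := fun x =>
    ⟨_, Polynomial.monic_X_pow_sub_C _ hp.ne_zero, hroot x⟩
  have hfin : FiniteDimensional E E⟮t⟯ := IntermediateField.adjoin.finiteDimensional (hint t)
  -- K = K^p(t), and t is a root of X^p - t^p.
  have hle : Module.finrank E K ≤ p := by
    rw [← IntermediateField.finrank_top', ← ht, IntermediateField.adjoin.finrank (hint t)]
    refine (Polynomial.natDegree_le_of_dvd (minpoly.dvd E t (hroot t))
      (Polynomial.monic_X_pow_sub_C _ hp.ne_zero).ne_zero).trans_eq ?_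
    exact Polynomial.natDegree_X_pow_sub_C
  have hfinK : FiniteDimensional E K := by
    rw [ht] at hfin
    exact Module.Finite.of_surjective (IntermediateField.topEquiv (F := E) (E := K)).toLinearMap
      IntermediateField.topEquiv.surjective
  -- X^p - π^p is irreducible over K^p, since a root there would make π a p-th power. So K^p(π)
  -- already has the largest possible degree.
  have heq : Module.finrank E E⟮π⟯ = p := by
    have hirr : Irreducible (Polynomial.X ^ p - Polynomial.C (⟨π ^ p, hpow π⟩ : E)) := by
      refine X_pow_sub_C_irreducible_of_prime hp ?_
      rintro ⟨_, c, rfl⟩ h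
      have h' : (c ^ p) ^ p = π ^ p := congrArg Subtype.val h
      exact hπ c (frobenius_inj K p h')
    rw [IntermediateField.adjoin.finrank (hint π),
      ← minpoly.eq_of_irreducible_of_monic hirr (hroot π)
        (Polynomial.monic_X_pow_sub_C _ hp.ne_zero)]
    exact Polynomial.natDegree_X_pow_sub_C
  refine IntermediateField.eq_of_le_of_finrank_le le_top ?_
  rw [IntermediateField.finrank_top', heq]
  exact hle

/-- By the Leibniz rules the x with dx ∈ K dπ form a subfield; it contains π, and it contains K^p
because d(c^p) = 0. -/
theorem span_D_eq_top [PerfectField k] (p : ℕ) [Fact p.Prime] [CharP K p]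
    (hfg : (⊤ : IntermediateField k K).FG) (htr : Algebra.trdeg k K = 1) {π : K}
    (hπ : ∀ c : K, c ^ p ≠ π) :
    Submodule.span K {KaehlerDifferential.D k K π} = ⊤ := by
  rw [eq_top_iff, ← KaehlerDifferential.span_range_derivation, Submodule.span_le]
  rintro _ ⟨x, rfl⟩
  have hx : x ∈ IntermediateField.adjoin (frobenius K p).fieldRange {π} := by
    rw [adjoin_fieldRange_frobenius_eq_top p hfg htr hπ]; trivial
  change KaehlerDifferential.D k K x ∈ Submodule.span K {KaehlerDifferential.D k K π}
  induction hx using IntermediateField.adjoin_induction with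
  | mem y hy => rw [Set.mem_singleton_iff.1 hy]; exact Submodule.mem_span_singleton_self _
  | algebraMap y =>
    obtain ⟨_, c, rfl⟩ := y
    have : KaehlerDifferential.D k K (c ^ p) = 0 := by
      rw [Derivation.leibniz_pow, ← Nat.cast_smul_eq_nsmul K, CharP.cast_eq_zero, zero_smul]
    change KaehlerDifferential.D k K (c ^ p) ∈ _
    rw [this]
    exact zero_mem _
  | add x y _ _ hx hy => rw [map_add]; exact add_mem hx hy
  | inv x _ hx =>
    rw [Derivation.leibniz_inv]
    exact Submodule.smul_mem _ _ hx
  | mul x y _ _ hx hy =>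
    rw [Derivation.leibniz]
    exact add_mem (Submodule.smul_mem _ _ hy) (Submodule.smul_mem _ _ hx)

end Differentials

/-! ### The differential of a uniformizer -/

section

variable {Fq A K C : Type*} [Field Fq] [Fintype Fq] [Field K] [NormedField C]
  [CompleteSpace C] [Algebra K C] {O : ValuationSubring K}

/-- The valuation of a nonzero p-th power is divisible by p, while that of π is 1. -/
theorem pow_ne_uniformizer (hC : IsCInfty Fq C O) {π : K}
    (hπ : ‖algebraMap K C π‖ = (Fintype.card Fq : ℝ)⁻¹) {p : ℕ} (hp : p ≠ 1) (c : K) :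
    c ^ p ≠ π := by
  have hq := one_lt_card Fq
  rintro rfl
  rcases eq_or_ne c 0 with rfl | hc
  · rcases Nat.eq_zero_or_pos p with rfl | hp0
    · have : Fintype.card Fq = 1 := by simpa using hπ
      exact hq.ne (by exact_mod_cast this.symm)
    · rw [zero_pow hp0.ne', map_zero, norm_zero] at hπ
      exact absurd hπ.symm (by positivity)
  · obtain ⟨n, hn⟩ := hC.norm_eq_zpow c hc
    rw [map_pow, norm_pow, hn, ← zpow_natCast, ← zpow_mul, ← zpow_neg_one] at hπ
    have h := zpow_right_injective₀ (by linarith) hq.ne' hπ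
    have h2 : (p : ℤ) ∣ 1 := ⟨-n, by linarith⟩
    exact hp (by exact_mod_cast Int.eq_one_of_dvd_one (by positivity) h2)

theorem span_D_uniformizer_eq_top [CommRing A] [Algebra Fq K] [Algebra A K]
    (hA : IsRingOfFunctionsAwayFrom Fq A O) (hC : IsCInfty Fq C O)
    {π : K} (hπ : ‖algebraMap K C π‖ = (Fintype.card Fq : ℝ)⁻¹) :
    Submodule.span K {KaehlerDifferential.D Fq K π} = ⊤ := by
  obtain ⟨p, hp⟩ := CharP.exists Fq
  have : CharP K p := (RingHom.charP_iff (algebraMap Fq K) (algebraMap Fq K).injective p).1 hp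
  have hprime : p.Prime := CharP.char_is_prime Fq p
  have : Fact p.Prime := ⟨hprime⟩
  exact span_D_eq_top p hA.fg hA.trdeg_eq_one (pow_ne_uniformizer hC hπ hprime.ne_one)

end

/-! ### Laurent expansions and residues in `K_∞` -/

theorem norm_le_of_hasSum {C ι : Type*} [NormedField C] [IsUltrametricDist C] {f : ι → C} {x : C}
    (h : HasSum f x) {B : ℝ} (hB : 0 ≤ B) (hf : ∀ i, ‖f i‖ ≤ B) : ‖x‖ ≤ B := by
  rw [← h.tsum_eq]
  exact (IsUltrametricDist.norm_tsum_le f).trans (Real.iSup_le hf hB)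

section Approximation

variable {Fq K C : Type*} [Field Fq] [Field K] [NormedField C] [Algebra K C]
  {O : ValuationSubring K}

theorem algebraMap_mem_kInfty (x : K) : algebraMap K C x ∈ kInfty K C :=
  Subfield.le_topologicalClosure _ ⟨x, rfl⟩

theorem isClosed_kInfty : IsClosed (kInfty K C : Set C) :=
  Subfield.isClosed_topologicalClosure _

theorem exists_norm_sub_lt_of_mem_kInfty {x : C} (hx : x ∈ kInfty K C) {ε : ℝ} (hε : 0 < ε) :
    ∃ y : K, ‖algebraMap K C y - x‖ < ε := by
  have hx' : x ∈ closure (Set.range (algebraMap K C)) := hx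
  obtain ⟨_, ⟨y, rfl⟩, hy⟩ := Metric.mem_closure_iff.1 hx' ε hε
  exact ⟨y, by rwa [dist_comm, dist_eq_norm] at hy⟩

theorem smul_mem_kInfty [Algebra Fq K] [Algebra Fq C] [IsScalarTower Fq K C] (c : Fq) {x : C} (hx : x ∈ kInfty K C) : c • x ∈ kInfty K C := by
  rw [Algebra.smul_def, IsScalarTower.algebraMap_apply Fq K C]
  exact mul_mem (algebraMap_mem_kInfty _) hx

variable [Fintype Fq] [CompleteSpace C] [IsUltrametricDist C]

theorem exists_norm_eq_zpow_of_mem_kInfty (hC : IsCInfty Fq C O) {x : C} (hx : x ∈ kInfty K C)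
    (hx0 : x ≠ 0) : ∃ n : ℤ, ‖x‖ = (Fintype.card Fq : ℝ) ^ n := by
  obtain ⟨y, hy⟩ := exists_norm_sub_lt_of_mem_kInfty hx (norm_pos_iff.2 hx0)
  have h := norm_eq_of_norm_sub_lt hy
  rw [← h]
  refine hC.norm_eq_zpow y ?_
  rintro rfl
  rw [map_zero, norm_zero] at h
  exact hx0 (norm_eq_zero.1 h.symm)

theorem norm_le_zpow_of_norm_lt_zpow (hC : IsCInfty Fq C O) {x : C} (hx : x ∈ kInfty K C) {n : ℤ}
    (h : ‖x‖ < (Fintype.card Fq : ℝ) ^ (n + 1)) : ‖x‖ ≤ (Fintype.card Fq : ℝ) ^ n := by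
  have hq := one_lt_card Fq
  rcases eq_or_ne x 0 with rfl | hx0
  · rw [norm_zero]; positivity
  obtain ⟨m, hm⟩ := exists_norm_eq_zpow_of_mem_kInfty hC hx hx0
  rw [hm, zpow_lt_zpow_iff_right₀ hq] at h
  rw [hm, zpow_le_zpow_iff_right₀ hq]
  omega

variable [Algebra Fq K] [Algebra Fq C] [IsScalarTower Fq K C]

/-- Approximate x and y by elements of K with error below ‖y‖ and cancel the leading term there. -/
theorem exists_norm_sub_smul_lt_of_mem_kInfty {A : Type*} [CommRing A] [Algebra A K]
    (hA : IsRingOfFunctionsAwayFrom Fq A O) (hC : IsCInfty Fq C O) {x y : C}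
    (hx : x ∈ kInfty K C) (hy : y ∈ kInfty K C) (hy0 : y ≠ 0) (h : ‖x‖ ≤ ‖y‖) :
    ∃ c : Fq, ‖x - c • y‖ < ‖y‖ := by
  obtain ⟨u, hu⟩ := exists_norm_sub_lt_of_mem_kInfty hx (norm_pos_iff.2 hy0)
  obtain ⟨v, hv⟩ := exists_norm_sub_lt_of_mem_kInfty hy (norm_pos_iff.2 hy0)
  have hv' := norm_eq_of_norm_sub_lt hv
  have hv0 : v ≠ 0 := by
    rintro rfl
    rw [map_zero, norm_zero] at hv'
    exact hy0 (norm_eq_zero.1 hv'.symm)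
  have hu' : ‖algebraMap K C u‖ ≤ ‖y‖ := by
    simpa using norm_add_le_of_le hu.le h
  obtain ⟨c, hc⟩ := exists_norm_sub_smul_lt hA hC hv0 (hu'.trans_eq hv'.symm)
  rw [hv'] at hc
  refine ⟨c, ?_⟩
  have : x - c • y = (algebraMap K C u - c • algebraMap K C v) +
      (c • (algebraMap K C v - y) + -(algebraMap K C u - x)) := by
    rw [smul_sub]; ring
  rw [this]
  refine (IsUltrametricDist.norm_add_le_max _ _).trans_lt (max_lt hc ?_)
  refine (IsUltrametricDist.norm_add_le_max _ _).trans_lt (max_lt ?_ (by rwa [norm_neg]))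
  exact (norm_smul_le' _ _).trans_lt hv

end Approximation

/-! ### Uniqueness of Laurent coefficients -/

section Expansion

theorem norm_uniformizer_zpow {Fq C : Type*} [Fintype Fq] [NormedField C] {ϖ : C}
    (hϖ : ‖ϖ‖ = (Fintype.card Fq : ℝ)⁻¹) (n : ℤ) : ‖ϖ ^ n‖ = (Fintype.card Fq : ℝ) ^ (-n) := by
  rw [norm_zpow, hϖ, inv_zpow, zpow_neg]

variable {Fq C : Type*} [Field Fq] [NormedField C] [Algebra Fq C]

/-- `x = ∑ c_n ϖ ^ n`. -/
def IsExpansion (ϖ : C) (c : ℤ → Fq) (x : C) : Prop :=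
  HasSum (fun n : ℤ => c n • ϖ ^ n) x

open Classical in
variable (Fq) in
/-- The coefficient of `ϖ⁻¹` in the expansion of `x`. -/
noncomputable def residue (ϖ x : C) : Fq :=
  if h : ∃ c : ℤ → Fq, IsExpansion ϖ c x then h.choose (-1) else 0

variable {ϖ x y : C} {c d : ℤ → Fq}

theorem IsExpansion.add (hx : IsExpansion ϖ c x) (hy : IsExpansion ϖ d y) :
    IsExpansion ϖ (c + d) (x + y) := by
  simpa [IsExpansion, add_smul] using HasSum.add hx hy

theorem IsExpansion.smul (hx : IsExpansion ϖ c x) (k : Fq) : IsExpansion ϖ (k • c) (k • x) := by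
  have := HasSum.mul_left (algebraMap Fq C k) hx
  simpa [IsExpansion, Algebra.smul_def, mul_assoc] using this

variable [Fintype Fq] [IsUltrametricDist C]

theorem IsExpansion.norm_le (hϖ : ‖ϖ‖ = (Fintype.card Fq : ℝ)⁻¹) (hx : IsExpansion ϖ c x) {m : ℤ}
    (hc : ∀ n < m, c n = 0) : ‖x‖ ≤ (Fintype.card Fq : ℝ) ^ (-m) := by
  have hq := one_lt_card Fq
  refine norm_le_of_hasSum hx (by positivity) fun n => ?_
  rcases lt_or_ge n m with h | h
  · rw [hc n h, zero_smul, norm_zero]; positivity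
  · refine (norm_smul_le' _ _).trans ?_
    rw [norm_uniformizer_zpow hϖ, zpow_le_zpow_iff_right₀ hq]
    omega

/-- The terms tend to zero, so only finitely many nonzero coefficients have index at most n. The
lowest of them, of index k, dominates all other terms and forces ‖x‖ = q^(-k). -/
theorem IsExpansion.coeff_eq_zero (hϖ : ‖ϖ‖ = (Fintype.card Fq : ℝ)⁻¹) (hx : IsExpansion ϖ c x)
    {m : ℤ} (hm : ‖x‖ ≤ (Fintype.card Fq : ℝ) ^ (-m)) {n : ℤ} (hn : n < m) : c n = 0 := by
  have hq := one_lt_card Fq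
  by_contra hne
  have hfin : {i : ℤ | i ≤ n ∧ c i ≠ 0}.Finite := by
    have h0 := HasSum.summable hx |>.tendsto_cofinite_zero
    have h1 := (Metric.tendsto_nhds.1 h0) ((Fintype.card Fq : ℝ) ^ (-n)) (by positivity)
    rw [Filter.eventually_cofinite] at h1
    refine h1.subset fun i hi => ?_
    change ¬ dist (c i • ϖ ^ i) 0 < _
    rw [dist_zero_right, norm_smul_eq hi.2, norm_uniformizer_zpow hϖ, not_lt,
      zpow_le_zpow_iff_right₀ hq]
    exact neg_le_neg hi.1
  obtain ⟨k, ⟨hk1, hk2⟩, hk3⟩ := hfin.exists_minimal ⟨n, le_rfl, hne⟩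
  have hlow : ∀ i < k, c i = 0 := fun i hi => by
    by_contra h
    exact absurd (hk3 ⟨by omega, h⟩ hi.le) (by omega)
  have hdiff : IsExpansion ϖ (c + -Pi.single k (c k)) (x + -(c k • ϖ ^ k)) := by
    refine hx.add ?_
    have : HasSum (fun i : ℤ => (Pi.single k (c k) : ℤ → Fq) i • ϖ ^ i) (c k • ϖ ^ k) := by
      convert hasSum_single k (f := fun i : ℤ => (Pi.single k (c k) : ℤ → Fq) i • ϖ ^ i) ?_ using 1
      · simp
      · intro i hi; simp [hi]
    simpa [IsExpansion] using this.neg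
  have hle := hdiff.norm_le hϖ (m := k + 1) fun i hi => by
    rcases eq_or_ne i k with rfl | hik
    · simp
    · simp [hik, hlow i (by omega)]
  have hnk : ‖c k • ϖ ^ k‖ = (Fintype.card Fq : ℝ) ^ (-k) := by
    rw [norm_smul_eq hk2, norm_uniformizer_zpow hϖ]
  have hlt : ‖x - c k • ϖ ^ k‖ < ‖c k • ϖ ^ k‖ := by
    rw [sub_eq_add_neg, hnk]
    refine hle.trans_lt ((zpow_lt_zpow_iff_right₀ hq).2 (by omega))
  have heq := norm_eq_of_norm_sub_lt hlt
  rw [heq, hnk, zpow_le_zpow_iff_right₀ hq] at hm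
  omega

/-- The difference of two expansions of x is an expansion of 0, so its coefficients vanish; the
choice made in `residue` is immaterial. -/
theorem IsExpansion.residue_eq (hϖ : ‖ϖ‖ = (Fintype.card Fq : ℝ)⁻¹) (hx : IsExpansion ϖ c x) :
    residue Fq ϖ x = c (-1) := by
  have h : ∃ c : ℤ → Fq, IsExpansion ϖ c x := ⟨c, hx⟩
  have h0 := h.choose_spec.add (hx.smul (-1))
  rw [neg_one_smul, neg_one_smul, add_neg_cancel] at h0
  have := h0.coeff_eq_zero hϖ (m := 0) (n := -1) (by simp) (by omega)
  rw [residue, dif_pos h]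
  simpa [add_neg_eq_zero] using this

end Expansion

/-! ### Existence of expansions and residue duality -/

section Residue

variable {Fq K C : Type*} [Field Fq] [Fintype Fq] [Field K] [NormedField C] [CompleteSpace C]
  [IsUltrametricDist C] [Algebra K C] {O : ValuationSubring K}
  [Algebra Fq K] [Algebra Fq C] [IsScalarTower Fq K C] {A : Type*} [CommRing A] [Algebra A K]
  {π : K} {x y : C}

local notation "q" => (Fintype.card Fq : ℝ)

/-- Digits are extracted greedily: subtracting a multiple of ϖ^n makes the remainder strictly
smaller than q^(-n), hence at most q^(-n-1), as the norm on K_∞ takes only powers of q as nonzero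
values. -/
theorem exists_isExpansion (hA : IsRingOfFunctionsAwayFrom Fq A O) (hC : IsCInfty Fq C O)
    (hπ : ‖algebraMap K C π‖ = q⁻¹) (hx : x ∈ kInfty K C) :
    ∃ c : ℤ → Fq, IsExpansion (algebraMap K C π) c x := by
  have hq := one_lt_card Fq
  set ϖ := algebraMap K C π with hϖdef
  have hϖ : ϖ ∈ kInfty K C := algebraMap_mem_kInfty π
  have hϖ0 : ϖ ≠ 0 := by
    intro h
    rw [h, norm_zero] at hπ
    exact absurd hπ (by positivity)
  have hdigit : ∀ (n : ℤ) (y : {y : C // y ∈ kInfty K C ∧ ‖y‖ ≤ q ^ (-n)}),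
      ∃ c : Fq, ‖y.1 - c • ϖ ^ n‖ ≤ q ^ (-(n + 1)) := by
    rintro n ⟨y, hy, hyn⟩
    have hmem := zpow_mem hϖ n
    obtain ⟨c, hc⟩ := exists_norm_sub_smul_lt_of_mem_kInfty hA hC hy hmem
      (zpow_ne_zero n hϖ0) (hyn.trans_eq (norm_uniformizer_zpow hπ n).symm)
    refine ⟨c, norm_le_zpow_of_norm_lt_zpow hC (sub_mem hy (smul_mem_kInfty c hmem)) ?_⟩
    rwa [norm_uniformizer_zpow hπ, show -n = -(n + 1) + 1 by ring] at hc
  choose dig hdig using hdigit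
  obtain ⟨n₀, hn₀⟩ : ∃ n₀ : ℤ, ‖x‖ ≤ q ^ (-n₀) := by
    obtain ⟨n, hn⟩ := pow_unbounded_of_one_lt ‖x‖ hq
    exact ⟨-n, by simpa using hn.le⟩
  let X : (k : ℕ) → {y : C // y ∈ kInfty K C ∧ ‖y‖ ≤ q ^ (-(n₀ + k))} := fun k =>
    Nat.rec ⟨x, hx, by simpa using hn₀⟩ (fun k y => ⟨y.1 - dig _ y • ϖ ^ (n₀ + k),
      sub_mem y.2.1 (smul_mem_kInfty _ (zpow_mem hϖ _)), by
        have := hdig _ y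
        rwa [Nat.cast_succ, ← add_assoc]⟩) k
  let e : ℕ → Fq := fun k => dig _ (X k)
  have hX0 : (X 0).1 = x := rfl
  have hXs : ∀ k, (X (k + 1)).1 = (X k).1 - e k • ϖ ^ (n₀ + k) := fun k => rfl
  have hpart : ∀ k, ∑ i ∈ Finset.range k, e i • ϖ ^ (n₀ + i) = x - (X k).1 := fun k => by
    induction k with
    | zero => simp [hX0]
    | succ k ih => rw [Finset.sum_range_succ, ih, hXs]; ring
  have hbound : Filter.Tendsto (fun k : ℕ => q ^ (-(n₀ + k))) Filter.atTop (nhds 0) := by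
    have h := (tendsto_pow_atTop_nhds_zero_of_lt_one (r := q⁻¹) (by positivity)
      (inv_lt_one_of_one_lt₀ hq)).const_mul (q ^ (-n₀))
    rw [mul_zero] at h
    refine h.congr fun k => ?_
    rw [neg_add, zpow_add₀ (by positivity), zpow_neg q k, zpow_natCast, inv_pow]
  have hXlim : Filter.Tendsto (fun k => (X k).1) Filter.atTop (nhds 0) :=
    squeeze_zero_norm (fun k => (X k).2.2) hbound
  have hterm : Filter.Tendsto (fun k : ℕ => e k • ϖ ^ (n₀ + k)) Filter.cofinite (nhds 0) := by
    rw [Nat.cofinite_eq_atTop]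
    refine squeeze_zero_norm (fun k => (norm_smul_le' _ _).trans ?_) hbound
    rw [norm_uniformizer_zpow hπ]
  have hsum : HasSum (fun k : ℕ => e k • ϖ ^ (n₀ + k)) x := by
    rw [(NonarchimedeanAddGroup.summable_of_tendsto_cofinite_zero hterm).hasSum_iff_tendsto_nat]
    simp only [hpart]
    simpa using hXlim.const_sub x
  have hinj : Function.Injective fun k : ℕ => n₀ + (k : ℤ) := fun i k h => by
    simpa using h
  refine ⟨Function.extend (fun k : ℕ => n₀ + (k : ℤ)) e 0, ?_⟩
  rw [IsExpansion, ← hinj.hasSum_iff]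
  · convert hsum using 2 with k
    simp [hinj.extend_apply]
  · intro n hn
    rw [Function.extend_apply' _ _ _ (by simpa using hn)]
    simp

theorem residue_add (hA : IsRingOfFunctionsAwayFrom Fq A O) (hC : IsCInfty Fq C O)
    (hπ : ‖algebraMap K C π‖ = q⁻¹) (hx : x ∈ kInfty K C) (hy : y ∈ kInfty K C) :
    residue Fq (algebraMap K C π) (x + y) =
      residue Fq (algebraMap K C π) x + residue Fq (algebraMap K C π) y := by
  obtain ⟨c, hc⟩ := exists_isExpansion hA hC hπ hx
  obtain ⟨d, hd⟩ := exists_isExpansion hA hC hπ hy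
  rw [hc.residue_eq hπ, hd.residue_eq hπ, (hc.add hd).residue_eq hπ, Pi.add_apply]

theorem residue_smul (hA : IsRingOfFunctionsAwayFrom Fq A O) (hC : IsCInfty Fq C O)
    (hπ : ‖algebraMap K C π‖ = q⁻¹) (k : Fq) (hx : x ∈ kInfty K C) :
    residue Fq (algebraMap K C π) (k • x) = k * residue Fq (algebraMap K C π) x := by
  obtain ⟨c, hc⟩ := exists_isExpansion hA hC hπ hx
  rw [hc.residue_eq hπ, (hc.smul k).residue_eq hπ, Pi.smul_apply, smul_eq_mul]

theorem residue_eq_zero (hA : IsRingOfFunctionsAwayFrom Fq A O) (hC : IsCInfty Fq C O)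
    (hπ : ‖algebraMap K C π‖ = q⁻¹) (hx : x ∈ kInfty K C) (h : ‖x‖ ≤ 1) :
    residue Fq (algebraMap K C π) x = 0 := by
  obtain ⟨c, hc⟩ := exists_isExpansion hA hC hπ hx
  rw [hc.residue_eq hπ]
  exact hc.coeff_eq_zero hπ (m := 0) (by simpa using h) (by omega)

theorem residue_ne_zero (hA : IsRingOfFunctionsAwayFrom Fq A O) (hC : IsCInfty Fq C O)
    (hπ : ‖algebraMap K C π‖ = q⁻¹) (hx : x ∈ kInfty K C) (h : ‖x‖ = q) :
    residue Fq (algebraMap K C π) x ≠ 0 := by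
  obtain ⟨c, hc⟩ := exists_isExpansion hA hC hπ hx
  rw [hc.residue_eq hπ]
  intro h0
  have := hc.norm_le hπ (m := 0) fun n hn => by
    rcases eq_or_ne n (-1) with rfl | hne
    · exact h0
    · exact hc.coeff_eq_zero hπ (m := -1) (by simp [h]) (by omega)
  rw [h, neg_zero, zpow_zero] at this
  exact absurd this (not_le.2 (one_lt_card Fq))

/-- A functional on a subspace of `K_∞` which vanishes on the elements of small norm is given by
the residue pairing with a small element of `K_∞`. -/
theorem exists_residue_mul_eq (hA : IsRingOfFunctionsAwayFrom Fq A O) (hC : IsCInfty Fq C O)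
    (hπ : ‖algebraMap K C π‖ = q⁻¹) {M : Type*} [AddCommGroup M] [Module Fq M] (g : M →ₗ[Fq] C)
    (hg : ∀ m, g m ∈ kInfty K C) (χ : Module.Dual Fq M) (N : ℕ)
    (hχ : ∀ m, ‖g m‖ ≤ q ^ N → χ m = 0) :
    ∃ b ∈ kInfty K C, ‖b‖ ≤ (q ^ N)⁻¹ ∧
      ∀ m, residue Fq (algebraMap K C π) (b * g m) = χ m := by
  have hq := one_lt_card Fq
  set ϖ := algebraMap K C π with hϖdef
  have hϖ : ϖ ∈ kInfty K C := algebraMap_mem_kInfty π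
  -- Adding a multiple of ϖ^(N+k) to b leaves the residues against norm at most q^(N+k) unchanged.
  -- One element m₀ of the next norm determines the correction, since any other differs from a
  -- constant multiple of m₀ by something of smaller norm.
  have hstep : ∀ (k : ℕ) (b : {b : C // b ∈ kInfty K C ∧
      ∀ m, ‖g m‖ ≤ q ^ (N + k) → residue Fq ϖ (b * g m) = χ m}),
      ∃ b' : {b : C // b ∈ kInfty K C ∧
        ∀ m, ‖g m‖ ≤ q ^ (N + k + 1) → residue Fq ϖ (b * g m) = χ m},
        ‖b'.1 - b.1‖ ≤ (q ^ (N + k))⁻¹ := by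
    rintro k ⟨b, hb, hbm⟩
    have hϖn : ‖ϖ ^ (N + k)‖ = (q ^ (N + k))⁻¹ := by rw [norm_pow, hπ, inv_pow]
    have hdich : ∀ m, ‖g m‖ ≤ q ^ (N + k + 1) → ‖g m‖ ≤ q ^ (N + k) ∨ ‖g m‖ = q ^ (N + k + 1) := by
      intro m hm
      rcases hm.lt_or_eq with h | h
      · left
        have := norm_le_zpow_of_norm_lt_zpow hC (hg m) (n := (N + k : ℕ)) (by exact_mod_cast h)
        exact_mod_cast this
      · exact Or.inr h
    by_cases hex : ∃ m, ‖g m‖ = q ^ (N + k + 1)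
    · obtain ⟨m₀, hm₀⟩ := hex
      have hg0 : g m₀ ≠ 0 := by
        intro h
        rw [h, norm_zero] at hm₀
        exact absurd hm₀ (by positivity)
      have hmem : ϖ ^ (N + k) * g m₀ ∈ kInfty K C := mul_mem (pow_mem hϖ _) (hg m₀)
      have hne : residue Fq ϖ (ϖ ^ (N + k) * g m₀) ≠ 0 := by
        refine residue_ne_zero hA hC hπ hmem ?_
        rw [norm_mul, hϖn, hm₀, pow_succ, inv_mul_cancel_left₀ (by positivity)]
      let β : Fq := (χ m₀ - residue Fq ϖ (b * g m₀)) / residue Fq ϖ (ϖ ^ (N + k) * g m₀)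
      have hres : ∀ m, residue Fq ϖ ((b + β • ϖ ^ (N + k)) * g m) =
          residue Fq ϖ (b * g m) + β * residue Fq ϖ (ϖ ^ (N + k) * g m) := fun m => by
        have hmem' : ϖ ^ (N + k) * g m ∈ kInfty K C := mul_mem (pow_mem hϖ _) (hg m)
        rw [add_mul, smul_mul_assoc, residue_add hA hC hπ (mul_mem hb (hg m))
          (smul_mem_kInfty β hmem'), residue_smul hA hC hπ β hmem']
      have hlow : ∀ m, ‖g m‖ ≤ q ^ (N + k) →
          residue Fq ϖ ((b + β • ϖ ^ (N + k)) * g m) = χ m := fun m hm => by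
        rw [hres, hbm m hm, residue_eq_zero hA hC hπ (mul_mem (pow_mem hϖ _) (hg m)), mul_zero,
          add_zero]
        rw [norm_mul, hϖn]
        exact inv_mul_le_one_of_le₀ hm (by positivity)
      have htop : residue Fq ϖ ((b + β • ϖ ^ (N + k)) * g m₀) = χ m₀ := by
        rw [hres, div_mul_cancel₀ _ hne]; ring
      have hb' : b + β • ϖ ^ (N + k) ∈ kInfty K C :=
        add_mem hb (smul_mem_kInfty β (pow_mem hϖ _))
      refine ⟨⟨b + β • ϖ ^ (N + k), hb', fun m hm => ?_⟩, ?_⟩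
      · obtain ⟨c, hc⟩ := exists_norm_sub_smul_lt_of_mem_kInfty hA hC (hg m) (hg m₀) hg0
          (hm.trans_eq hm₀.symm)
        rw [← map_smul, ← map_sub, hm₀] at hc
        have h1 := hlow (m - c • m₀) (by
          have := norm_le_zpow_of_norm_lt_zpow hC (hg (m - c • m₀)) (n := (N + k : ℕ))
            (by exact_mod_cast hc)
          exact_mod_cast this)
        have h2 : (b + β • ϖ ^ (N + k)) * g m = (b + β • ϖ ^ (N + k)) * g (m - c • m₀) +
            c • ((b + β • ϖ ^ (N + k)) * g m₀) := by
          rw [map_sub, map_smul, mul_sub, mul_smul_comm, sub_add_cancel]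
        rw [h2, residue_add hA hC hπ (mul_mem hb' (hg _)) (smul_mem_kInfty c (mul_mem hb' (hg _))),
          residue_smul hA hC hπ c (mul_mem hb' (hg _)), h1, htop]
        simp
      · simp only [add_sub_cancel_left]
        exact (norm_smul_le' _ _).trans hϖn.le
    · refine ⟨⟨b, hb, fun m hm => hbm m ((hdich m hm).resolve_right fun h => hex ⟨m, h⟩)⟩, ?_⟩
      simp only [sub_self, norm_zero]
      positivity
  choose next hnext using hstep
  -- The start b = 0 is legitimate because χ vanishes where ‖g m‖ ≤ q^N.
  let b : (k : ℕ) → {b : C // b ∈ kInfty K C ∧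
      ∀ m, ‖g m‖ ≤ q ^ (N + k) → residue Fq ϖ (b * g m) = χ m} := fun k =>
    Nat.rec ⟨0, zero_mem _, fun m hm => by
      rw [zero_mul, residue_eq_zero hA hC hπ (zero_mem _) (by simp), hχ m hm]⟩
      (fun k b => next k b) k
  have hb0 : (b 0).1 = 0 := rfl
  have hbs : ∀ k, ‖(b (k + 1)).1 - (b k).1‖ ≤ (q ^ (N + k))⁻¹ := fun k => hnext k (b k)
  have hdist : ∀ k i, ‖(b (k + i)).1 - (b k).1‖ ≤ (q ^ (N + k))⁻¹ := fun k i => by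
    induction i with
    | zero =>
      change ‖(b k).1 - (b k).1‖ ≤ _
      rw [sub_self, norm_zero]
      positivity
    | succ i ih =>
      have h := hbs (k + i)
      have h' : (q ^ (N + (k + i)))⁻¹ ≤ (q ^ (N + k))⁻¹ :=
        inv_anti₀ (by positivity) (pow_le_pow_right₀ hq.le (by omega))
      have h'' := norm_add_le_of_le (h.trans h') ih
      rw [sub_add_sub_cancel] at h''
      exact h''
  have hlim0 : Filter.Tendsto (fun k : ℕ => (q ^ (N + k))⁻¹) Filter.atTop (nhds 0) := by
    have h := (tendsto_pow_atTop_nhds_zero_of_lt_one (r := q⁻¹) (by positivity)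
      (inv_lt_one_of_one_lt₀ hq))
    refine ((Filter.tendsto_add_atTop_iff_nat N).2 h).congr fun k => ?_
    rw [inv_pow, add_comm]
  have hcauchy : CauchySeq fun k => (b k).1 := by
    refine cauchySeq_of_le_tendsto_0' (fun k : ℕ => (q ^ (N + k))⁻¹) (fun k l hkl => ?_) hlim0
    obtain ⟨i, rfl⟩ := Nat.exists_eq_add_of_le hkl
    rw [dist_comm, dist_eq_norm]
    exact hdist k i
  obtain ⟨β, hβ⟩ := cauchySeq_tendsto_of_complete hcauchy
  have hβK : β ∈ kInfty K C :=
    isClosed_kInfty.mem_of_tendsto hβ (Filter.Eventually.of_forall fun k => (b k).2.1)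
  have hβdist : ∀ k, ‖β - (b k).1‖ ≤ (q ^ (N + k))⁻¹ := fun k => by
    refine le_of_tendsto (hβ.sub_const (b k).1).norm ?_
    filter_upwards [Filter.eventually_ge_atTop k] with l hl
    obtain ⟨i, rfl⟩ := Nat.exists_eq_add_of_le hl
    exact hdist k i
  refine ⟨β, hβK, by simpa [hb0] using hβdist 0, fun m => ?_⟩
  obtain ⟨k, hk⟩ := pow_unbounded_of_one_lt ‖g m‖ hq
  have hk' : ‖g m‖ ≤ q ^ (N + k) := hk.le.trans (pow_le_pow_right₀ hq.le (by omega))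
  -- For k large enough the first summand has norm at most 1 and so no residue.
  have h1 : β * g m = (β - (b k).1) * g m + (b k).1 * g m := by ring
  rw [h1, residue_add hA hC hπ (mul_mem (sub_mem hβK (b k).2.1) (hg m)) (mul_mem (b k).2.1 (hg m)),
    (b k).2.2 m hk', residue_eq_zero hA hC hπ (mul_mem (sub_mem hβK (b k).2.1) (hg m)), zero_add]
  rw [norm_mul]
  calc _ ≤ (q ^ (N + k))⁻¹ * q ^ (N + k) :=
        mul_le_mul (hβdist k) hk' (norm_nonneg _) (by positivity)
    _ = 1 := inv_mul_cancel₀ (by positivity)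

end Residue

/-! ### Lattice points in balls -/

section Balls

variable {A C : Type*} [CommRing A] [NormedField C] [Algebra A C] {Λ : Submodule A C}

/-- The lattice points of norm at most `R`. -/
noncomputable def latticeBall (hΛ : IsLocallyFinite Λ) (R : ℝ) : Finset C :=
  (hΛ R).toFinset

theorem mem_latticeBall (hΛ : IsLocallyFinite Λ) {R : ℝ} {x : C} :
    x ∈ latticeBall hΛ R ↔ x ∈ Λ ∧ ‖x‖ ≤ R := by
  simp [latticeBall]

/-- A shortest nonzero lattice vector cannot be t times a lattice vector, which would be shorter
still. -/
theorem exists_mem_forall_ne_smul (hΛ : IsLocallyFinite Λ) (h0 : Λ ≠ ⊥) {t : A}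
    (ht : 1 < ‖algebraMap A C t‖) : ∃ μ ∈ Λ, ∀ x ∈ Λ, μ ≠ t • x := by
  obtain ⟨y, hy, hy0⟩ := Submodule.exists_mem_ne_zero_of_ne_bot h0
  have hfin : {x : C | x ∈ Λ ∧ ‖x‖ ≤ ‖y‖ ∧ x ≠ 0}.Finite :=
    (hΛ ‖y‖).subset fun x hx => ⟨hx.1, hx.2.1⟩
  obtain ⟨μ, ⟨h1, h2, h3⟩, hmin⟩ := Set.exists_min_image _ (fun x => ‖x‖) hfin ⟨y, hy, le_rfl, hy0⟩
  refine ⟨μ, h1, fun x hx hμ => ?_⟩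
  have hx0 : x ≠ 0 := by rintro rfl; simp [hμ] at h3
  have hlt : ‖x‖ < ‖μ‖ := by
    rw [hμ, Algebra.smul_def, norm_mul]
    exact lt_mul_of_one_lt_left (norm_pos_iff.2 hx0) ht
  exact absurd (hmin x ⟨hx, hlt.le.trans h2, hx0⟩) (not_le.2 hlt)

variable [IsUltrametricDist C]

theorem sub_mem_latticeBall (hΛ : IsLocallyFinite Λ) {R : ℝ} {x y : C}
    (hx : x ∈ latticeBall hΛ R) (hy : y ∈ latticeBall hΛ R) : x - y ∈ latticeBall hΛ R := by
  rw [mem_latticeBall] at *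
  exact ⟨sub_mem hx.1 hy.1, norm_sub_le_of_le hx.2 hy.2⟩

/-- With μ ∈ Λ outside tΛ, the images of the smaller ball under x ↦ t x and x ↦ μ - t x are disjoint
and lie in the larger ball once R ≥ ‖μ‖. -/
theorem exists_two_mul_card_latticeBall_le (hΛ : IsLocallyFinite Λ) (h0 : Λ ≠ ⊥) {t : A}
    (ht : 1 < ‖algebraMap A C t‖) : ∃ R₀ : ℝ, ∀ R ≥ R₀,
      2 * (latticeBall hΛ R).card ≤ (latticeBall hΛ (‖algebraMap A C t‖ * R)).card := by
  classical
  obtain ⟨μ, hμ, hne⟩ := exists_mem_forall_ne_smul hΛ h0 ht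
  have ht0 : algebraMap A C t ≠ 0 := fun h => by rw [h, norm_zero] at ht; linarith
  refine ⟨‖μ‖, fun R hR => ?_⟩
  have hR0 : 0 ≤ R := (norm_nonneg μ).trans hR
  have hmul : ∀ x ∈ latticeBall hΛ R, t • x ∈ latticeBall hΛ (‖algebraMap A C t‖ * R) := by
    intro x hx
    rw [mem_latticeBall] at *
    refine ⟨Λ.smul_mem t hx.1, ?_⟩
    rw [Algebra.smul_def, norm_mul]
    exact mul_le_mul_of_nonneg_left hx.2 (norm_nonneg _)
  have hμ' : μ ∈ latticeBall hΛ (‖algebraMap A C t‖ * R) :=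
    (mem_latticeBall hΛ).2 ⟨hμ, hR.le.trans (le_mul_of_one_le_left hR0 ht.le)⟩
  have hinj : Function.Injective fun x : C => t • x := fun x y h => by
    simpa [Algebra.smul_def, ht0] using h
  have hinj' : Function.Injective fun x : C => μ - t • x := fun x y h => hinj (by simpa using h)
  rw [two_mul]
  nth_rewrite 1 [← Finset.card_image_of_injective (latticeBall hΛ R) hinj]
  rw [← Finset.card_image_of_injective (latticeBall hΛ R) hinj', ← Finset.card_union_of_disjoint]
  · refine Finset.card_le_card (Finset.union_subset ?_ ?_)
    · exact Finset.image_subset_iff.2 hmul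
    · exact Finset.image_subset_iff.2 fun x hx => sub_mem_latticeBall hΛ hμ' (hmul x hx)
  · rw [Finset.disjoint_left]
    intro z hz hz'
    obtain ⟨x, hx, rfl⟩ := Finset.mem_image.1 hz
    obtain ⟨y, hy, hxy⟩ := Finset.mem_image.1 hz'
    refine hne (x + y) (add_mem ((mem_latticeBall hΛ).1 hx).1 ((mem_latticeBall hΛ).1 hy).1) ?_
    rw [smul_add]
    exact (sub_eq_iff_eq_add.1 hxy)

theorem exists_two_pow_mul_card_latticeBall_le (hΛ : IsLocallyFinite Λ) (h0 : Λ ≠ ⊥) {t : A}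
    (ht : 1 < ‖algebraMap A C t‖) (k : ℕ) : ∃ R₀ : ℝ, ∀ R ≥ R₀,
      2 ^ k * (latticeBall hΛ R).card ≤ (latticeBall hΛ (‖algebraMap A C t‖ ^ k * R)).card := by
  obtain ⟨R₁, hR₁⟩ := exists_two_mul_card_latticeBall_le hΛ h0 ht
  induction k with
  | zero => exact ⟨0, fun R _ => by simp⟩
  | succ k ih =>
    obtain ⟨R₀, hR₀⟩ := ih
    refine ⟨max (max R₀ R₁) 0, fun R hR => ?_⟩
    have h1 := hR₀ R (((le_max_left _ _).trans (le_max_left _ _)).trans hR)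
    have hR0 : 0 ≤ R := (le_max_right _ _).trans hR
    have h2 := hR₁ (‖algebraMap A C t‖ ^ k * R)
      ((((le_max_right _ _).trans (le_max_left _ _)).trans hR).trans
        (le_mul_of_one_le_left hR0 (one_le_pow₀ ht.le)))
    rw [← mul_assoc, ← pow_succ'] at h2
    calc 2 ^ (k + 1) * (latticeBall hΛ R).card
        = 2 * (2 ^ k * (latticeBall hΛ R).card) := by ring
      _ ≤ _ := (Nat.mul_le_mul_left 2 h1).trans h2

end Balls

/-! ### Finite approximations of the exponential function -/

section Exponential

variable {A C : Type*} [CommRing A] [NormedField C] [Algebra A C] {Λ : Submodule A C}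

open Classical in
/-- The polynomial `x ∏ (1 - x / λ)`, the product being over the nonzero elements of `V`. -/
noncomputable def finiteExp (V : Finset C) (x : C) : C :=
  x * ∏ y ∈ V.erase 0, (1 - x / y)

theorem injective_coe_nonzero : Function.Injective fun l : {l : Λ // l ≠ 0} => (l.1 : C) :=
  Subtype.val_injective.comp Subtype.val_injective

/-- The nonzero lattice points of norm at most `R`. -/
noncomputable def nonzeroBall (hΛ : IsLocallyFinite Λ) (R : ℝ) : Finset {l : Λ // l ≠ 0} :=
  (latticeBall hΛ R).preimage _ injective_coe_nonzero.injOn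

theorem norm_gt_of_notMem_nonzeroBall (hΛ : IsLocallyFinite Λ) {R : ℝ} {l : {l : Λ // l ≠ 0}}
    (hl : l ∉ nonzeroBall hΛ R) : R < ‖(l.1 : C)‖ := by
  simpa [nonzeroBall, mem_latticeBall] using hl

open Classical in
theorem image_nonzeroBall (hΛ : IsLocallyFinite Λ) (R : ℝ) :
    (nonzeroBall hΛ R).image (fun l => (l.1 : C)) = (latticeBall hΛ R).erase 0 := by
  ext x
  simp only [Finset.mem_image, nonzeroBall, Finset.mem_preimage, Finset.mem_erase]
  constructor
  · rintro ⟨l, hl, rfl⟩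
    exact ⟨by simpa using l.2, hl⟩
  · rintro ⟨hx0, hx⟩
    exact ⟨⟨⟨x, ((mem_latticeBall hΛ).1 hx).1⟩, by simpa using hx0⟩, hx, rfl⟩

open Classical in
theorem prod_nonzeroBall (hΛ : IsLocallyFinite Λ) (R : ℝ) (f : C → C) :
    ∏ l ∈ nonzeroBall hΛ R, f (l.1 : C) = ∏ y ∈ (latticeBall hΛ R).erase 0, f y := by
  rw [← image_nonzeroBall, Finset.prod_image injective_coe_nonzero.injOn]

open Classical in
theorem sum_nonzeroBall (hΛ : IsLocallyFinite Λ) (R : ℝ) (f : C → C) :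
    ∑ l ∈ nonzeroBall hΛ R, f (l.1 : C) = ∑ y ∈ (latticeBall hΛ R).erase 0, f y := by
  rw [← image_nonzeroBall, Finset.sum_image injective_coe_nonzero.injOn]

/-- The omitted factors are within ‖x‖ / R < 1 of 1. The truncation therefore has the same norm as
exp_Λ(x), so the relative error can be measured against exp_Λ(x), for which a uniform bound is
available later. -/
theorem norm_latticeExp_sub_le [CompleteSpace C] [IsUltrametricDist C] (hΛ : IsLocallyFinite Λ)
    {R : ℝ} {x : C} (hx : ‖x‖ < R) :
    ‖latticeExp Λ x - finiteExp (latticeBall hΛ R) x‖ ≤ ‖latticeExp Λ x‖ * (‖x‖ / R) := by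
  have hR : 0 < R := (norm_nonneg x).trans_lt hx
  have hlt : ‖x‖ / R < 1 := (div_lt_one hR).2 hx
  have htend : Filter.Tendsto (fun l : {l : Λ // l ≠ 0} => x / (l.1 : C)) Filter.cofinite
      (nhds 0) := by
    simpa [div_eq_mul_inv] using (tendsto_inv_lattice hΛ).const_mul x
  have h := norm_tprod_sub_prod_le htend (nonzeroBall hΛ R) (div_nonneg (norm_nonneg x) hR.le)
    hlt.le fun l hl => by
      rw [norm_div]
      exact div_le_div_of_nonneg_left (norm_nonneg _) hR (norm_gt_of_notMem_nonzeroBall hΛ hl).le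
  rw [prod_nonzeroBall hΛ R fun y => 1 - x / y] at h
  have h1 : ‖latticeExp Λ x - finiteExp (latticeBall hΛ R) x‖ ≤
      ‖finiteExp (latticeBall hΛ R) x‖ * (‖x‖ / R) := by
    rw [latticeExp, finiteExp, ← mul_sub, norm_mul, norm_mul, mul_assoc]
    exact mul_le_mul_of_nonneg_left h (norm_nonneg x)
  rcases eq_or_ne (finiteExp (latticeBall hΛ R) x) 0 with h0 | h0
  · rw [h0, norm_zero, zero_mul] at h1
    rw [h0]
    exact h1.trans (mul_nonneg (norm_nonneg _) (div_nonneg (norm_nonneg _) hR.le))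
  · have h2 : ‖latticeExp Λ x‖ = ‖finiteExp (latticeBall hΛ R) x‖ := by
      refine norm_eq_of_norm_sub_lt (h1.trans_lt ?_)
      exact mul_lt_of_lt_one_right (norm_pos_iff.2 h0) hlt
    rwa [h2]

open Polynomial Classical in
-- The summand is the value at x of the polynomial G = b^Q x^(Q-1) P(x)^Q, where E_F(bx) = b x P(x).
-- Its sum over all of V vanishes, so the sum over nonzero x is -G(0), and x^(Q-1) vanishes at 0
-- unless Q = 1.
theorem sum_finiteExp_pow_mul_inv {F : Finset C} {V : Finset C} (hF : (0 : C) ∈ F)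
    (hV0 : (0 : C) ∈ V) (hV : ∀ x ∈ V, ∀ y ∈ V, x - y ∈ V) {Q : ℕ} (hQ : 0 < Q)
    (hcard : Q * F.card < V.card) (b : C) :
    ∑ x ∈ V.erase 0, finiteExp F (b * x) ^ Q * x⁻¹ = -(if Q = 1 then b else 0) := by
  let P : C[X] := ∏ y ∈ F.erase 0, (1 - Polynomial.C (b / y) * X)
  let G : C[X] := Polynomial.C (b ^ Q) * (X ^ (Q - 1) * P ^ Q)
  have hPdeg : P.natDegree ≤ F.card - 1 := by
    refine (natDegree_prod_le _ _).trans ?_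
    rw [← Finset.card_erase_of_mem hF, Finset.card_eq_sum_ones]
    refine Finset.sum_le_sum fun y _ => ?_
    refine (natDegree_sub_le _ _).trans (max_le (by simp) ?_)
    exact (natDegree_C_mul_le _ _).trans natDegree_X_le
  -- The degree is at most (Q - 1) + Q (|F| - 1) = Q |F| - 1.
  have hGdeg : G.natDegree + 1 < V.card := by
    have h1 : G.natDegree ≤ Q - 1 + Q * (F.card - 1) := by
      refine (natDegree_C_mul_le _ _).trans (natDegree_mul_le.trans (add_le_add ?_ ?_))
      · exact natDegree_X_pow_le _
      · exact natDegree_pow_le.trans (Nat.mul_le_mul_left Q hPdeg)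
    have h2 : 0 < F.card := Finset.card_pos.2 ⟨0, hF⟩
    obtain ⟨n, hn⟩ := Nat.exists_eq_succ_of_ne_zero h2.ne'
    rw [hn] at h1 hcard
    rw [Nat.succ_sub_one] at h1
    rw [Nat.succ_eq_add_one, mul_add, mul_one] at hcard
    omega
  have hPeval : ∀ x, P.eval x = ∏ y ∈ F.erase 0, (1 - b * x / y) := fun x => by
    simp only [P, eval_prod, eval_sub, eval_one, eval_mul, Polynomial.eval_C, eval_X]
    exact Finset.prod_congr rfl fun y _ => by ring
  have hG0 : G.eval 0 = if Q = 1 then b else 0 := by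
    simp only [G, eval_mul, Polynomial.eval_C, eval_pow, eval_X, hPeval]
    split_ifs with h
    · simp [h]
    · rw [zero_pow (by omega)]; ring
  have hGx : ∀ x ∈ V.erase 0, finiteExp F (b * x) ^ Q * x⁻¹ = G.eval x := fun x hx => by
    have hx0 : x ≠ 0 := (Finset.mem_erase.1 hx).1
    simp only [G, eval_mul, Polynomial.eval_C, eval_pow, eval_X, hPeval, finiteExp]
    obtain ⟨n, rfl⟩ := Nat.exists_eq_succ_of_ne_zero hQ.ne'
    rw [Nat.succ_sub_one, Nat.succ_eq_add_one, mul_pow, mul_pow, pow_succ x n]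
    field_simp
  rw [Finset.sum_congr rfl hGx, ← hG0, eq_neg_iff_add_eq_zero, Finset.sum_erase_add _ _ hV0]
  exact sum_eval_eq_zero_of_degree_lt hV hGdeg

end Exponential

/-! ### Evaluation of the lattice sum for small b -/

section LatticeSum

variable {Fq A C : Type*} [Field Fq] [Fintype Fq] [CommRing A] [NormedField C] [Algebra Fq C]
  [Algebra A C] {Λ : Submodule A C}

variable (Fq) in
theorem sub_pow_card_pow (x y : C) (j : ℕ) : (x - y) ^ Fintype.card Fq ^ j =
    x ^ Fintype.card Fq ^ j - y ^ Fintype.card Fq ^ j := by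
  have h := map_sub ((FiniteField.frobeniusAlgHom Fq C) ^ j) x y
  simpa [AlgHom.coe_pow, FiniteField.coe_frobeniusAlgHom, pow_iterate] using h

variable [CompleteSpace C] [IsUltrametricDist C]

theorem summable_latticeExp_pow_mul_inv (hΛ : IsLocallyFinite Λ) {b : C} {B : ℝ}
    (hB : ∀ l ∈ Λ, ‖latticeExp Λ (b * l)‖ ≤ B) (Q : ℕ) :
    Summable fun l : {l : Λ // l ≠ 0} => latticeExp Λ (b * l.1) ^ Q * (l.1 : C)⁻¹ := by
  refine NonarchimedeanAddGroup.summable_of_tendsto_cofinite_zero ?_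
  refine squeeze_zero_norm (a := fun l => B ^ Q * ‖(l.1 : C)⁻¹‖) (fun l => ?_) ?_
  · rw [norm_mul, norm_pow]
    gcongr
    exact hB _ l.1.2
  · simpa using (tendsto_inv_lattice hΛ).norm.const_mul (B ^ Q)

/-- For small `b`, the sum `∑ exp_Λ(b λ) ^ (q ^ j) / λ` over the nonzero lattice points is
`-b` if `j = 0`, and vanishes if `j > 0`. -/
theorem exists_forall_tsum_latticeExp_eq (hΛ : IsLocallyFinite Λ) (h0 : Λ ≠ ⊥) {t : A}
    (ht : 1 < ‖algebraMap A C t‖) (j : ℕ) : ∃ ε > 0, ∀ b : C, ‖b‖ < ε → ∀ B : ℝ,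
      (∀ l ∈ Λ, ‖latticeExp Λ (b * l)‖ ≤ B) →
      ∑' l : {l : Λ // l ≠ 0}, latticeExp Λ (b * l.1) ^ Fintype.card Fq ^ j * (l.1 : C)⁻¹ =
        -(if j = 0 then b else 0) := by
  have hq : 1 < Fintype.card Fq := Fintype.one_lt_card
  set Q := Fintype.card Fq ^ j with hQdef
  have hQ : 0 < Q := by positivity
  have hQ1 : Q = 1 ↔ j = 0 := by rw [hQdef, Nat.pow_eq_one]; omega
  -- Dilating a large ball by c = ‖t‖^k multiplies its number of points by at least 2^k > Q.
  obtain ⟨k, hk⟩ := pow_unbounded_of_one_lt Q (one_lt_two (α := ℕ))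
  set c := ‖algebraMap A C t‖ ^ k with hc
  have hc1 : 1 ≤ c := one_le_pow₀ ht.le
  have hc0 : 0 < c := by linarith
  obtain ⟨R₀, hR₀⟩ := exists_two_pow_mul_card_latticeBall_le hΛ h0 ht k
  refine ⟨c⁻¹, by positivity, fun b hb B hB => ?_⟩
  have hbc : ‖b‖ * c < 1 := by rwa [← lt_inv_mul_iff₀' hc0, mul_one]
  have hB0 : 0 ≤ B := (norm_nonneg _).trans (hB 0 (zero_mem _))
  set f : {l : Λ // l ≠ 0} → C := fun l => latticeExp Λ (b * l.1) ^ Q * (l.1 : C)⁻¹ with hf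
  set T : C := if j = 0 then b else 0 with hT
  have hsum : Summable f := summable_latticeExp_pow_mul_inv hΛ hB Q
  -- The exponential is truncated at radius R and the sum at radius cR. Since ‖b‖ c < 1, every λ in
  -- the larger ball has ‖bλ‖ < R, where the truncated exponential is accurate.
  have key : ∀ R : ℝ, R₀ ≤ R → 1 ≤ R → ‖∑' l, f l - -T‖ ≤ B ^ Q * (1 + ‖b‖) / R := by
    intro R hR hR1
    have hRpos : 0 < R := by linarith
    have hzero : ∀ R' : ℝ, 0 ≤ R' → (0 : C) ∈ latticeBall hΛ R' := fun R' h =>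
      (mem_latticeBall hΛ).2 ⟨zero_mem _, by simpa using h⟩
    have hcard : Q * (latticeBall hΛ R).card < (latticeBall hΛ (c * R)).card := by
      refine lt_of_lt_of_le ?_ (hR₀ R hR)
      exact Nat.mul_lt_mul_of_pos_right hk (Finset.card_pos.2 ⟨0, hzero R hRpos.le⟩)
    have hfinite := sum_finiteExp_pow_mul_inv (hzero R hRpos.le) (hzero (c * R) (by positivity))
      (fun x hx y hy => sub_mem_latticeBall hΛ hx hy) hQ hcard b
    simp only [hQ1] at hfinite
    rw [← hT, ← sum_nonzeroBall hΛ (c * R) fun x =>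
      finiteExp (latticeBall hΛ R) (b * x) ^ Q * x⁻¹] at hfinite
    have htail : ‖∑' l, f l - ∑ l ∈ nonzeroBall hΛ (c * R), f l‖ ≤ B ^ Q * (1 + ‖b‖) / R := by
      rw [← hsum.sum_add_tsum_compl (s := nonzeroBall hΛ (c * R)), add_sub_cancel_left]
      refine (IsUltrametricDist.norm_tsum_le _).trans (Real.iSup_le (fun l => ?_) (by positivity))
      have hl : c * R < ‖(l.1.1 : C)‖ := norm_gt_of_notMem_nonzeroBall hΛ l.2
      have hl' : R ≤ ‖(l.1.1 : C)‖ := (le_mul_of_one_le_left hRpos.le hc1).trans hl.le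
      rw [hf, norm_mul, norm_pow, norm_inv, div_eq_mul_inv]
      refine mul_le_mul ?_ (inv_anti₀ hRpos hl') (by positivity) (by positivity)
      exact (pow_le_pow_left₀ (norm_nonneg _) (hB _ l.1.1.2) Q).trans
        (le_mul_of_one_le_right (by positivity) (by linarith [norm_nonneg b]))
    have happrox : ‖∑ l ∈ nonzeroBall hΛ (c * R), f l - -T‖ ≤ B ^ Q * (1 + ‖b‖) / R := by
      rw [← hfinite, ← Finset.sum_sub_distrib]
      refine IsUltrametricDist.norm_sum_le_of_forall_le_of_nonneg (by positivity) fun l hl => ?_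
      have hl0 : (l.1 : C) ≠ 0 := by simpa using l.2
      have hlR : ‖(l.1 : C)‖ ≤ c * R := by
        have := Finset.mem_preimage.1 hl
        exact ((mem_latticeBall hΛ).1 this).2
      have hbl : ‖b * (l.1 : C)‖ < R := by
        rw [norm_mul]
        calc ‖b‖ * ‖(l.1 : C)‖ ≤ ‖b‖ * (c * R) := by gcongr
          _ = (‖b‖ * c) * R := by ring
          _ < 1 * R := by gcongr
          _ = R := one_mul R
      have h1 := (norm_latticeExp_sub_le hΛ hbl).trans
        (mul_le_mul_of_nonneg_right (hB _ l.1.2) (by positivity))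
      -- Q is a power of q, so the difference of Q-th powers is the Q-th power of the difference.
      -- The factor ‖bλ‖ / R ≤ 1 dominates its own Q-th power, and its ‖λ‖ cancels the denominator,
      -- leaving a bound uniform in λ.
      rw [hf, ← sub_mul, ← sub_pow_card_pow Fq, norm_mul, norm_pow, norm_inv]
      have hδ : ‖b * (l.1 : C)‖ / R ≤ 1 := (div_le_one hRpos).2 hbl.le
      calc _ ≤ (B * (‖b * (l.1 : C)‖ / R)) ^ Q * ‖(l.1 : C)‖⁻¹ := by gcongr
        _ ≤ (B ^ Q * (‖b * (l.1 : C)‖ / R)) * ‖(l.1 : C)‖⁻¹ := by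
          rw [mul_pow]
          gcongr
          exact pow_le_of_le_one (by positivity) hδ hQ.ne'
        _ = B ^ Q * ‖b‖ / R := by
          rw [norm_mul]
          field_simp
        _ ≤ B ^ Q * (1 + ‖b‖) / R := by
          gcongr
          linarith
    have h := norm_add_le_of_le htail happrox
    rwa [sub_add_sub_cancel] at h
  rw [← sub_eq_zero, ← norm_le_zero_iff]
  refine ge_of_tendsto (tendsto_const_nhds.div_atTop Filter.tendsto_id :
    Filter.Tendsto (fun R : ℝ => B ^ Q * (1 + ‖b‖) / R) Filter.atTop (nhds 0)) ?_
  filter_upwards [Filter.eventually_ge_atTop R₀, Filter.eventually_ge_atTop 1] with R h1 h2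
  exact key R h1 h2

end LatticeSum

/-! ### The pairing with the universal dual special function -/

section Pairing

variable {Fq A C P : Type*} [Field Fq] [Fintype Fq] [CommRing A] [NormedField C]
  [Algebra Fq A] [Algebra Fq C] [Algebra A C] [IsScalarTower Fq A C]
  [AddCommGroup P] [Module A P] [Module Fq P] [IsScalarTower Fq A P] {Λ : Submodule A C}

/-- The map `λ ↦ w(n ↦ χ(n(λ)))`. -/
def evalLattice (w : CTensor Fq C (Λ →ₗ[A] P)) (χ : Module.Dual Fq P) : Λ →ₗ[Fq] C where
  toFun l := w.1 (dualEval l χ)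
  map_add' l l' := by
    rw [← map_add]
    congr 1
    ext n
    simp [dualEval]
  map_smul' k l := by
    rw [RingHom.id_apply, ← map_smul]
    congr 1
    ext n
    simp [dualEval]

/-- This justifies exchanging the two sums: all but finitely many λ give uniformly small terms, and
each remaining λ has finitely many nonzero coordinates. -/
theorem tendsto_ev_zeta_terms (hΛ : IsLocallyFinite Λ) {ι : Type*} (b : Module.Basis ι Fq Λ)
    {G : Λ → C} {B : ℝ} (hB : ∀ l, ‖G l‖ ≤ B) :
    Filter.Tendsto (fun x : ι × {l : Λ // l ≠ 0} =>
      (b.coord x.1 x.2.1 • (x.2.1 : C)⁻¹) * G (b x.1)) Filter.cofinite (nhds 0) := by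
  have hB0 : 0 ≤ B := (norm_nonneg _).trans (hB 0)
  rw [Metric.tendsto_nhds]
  intro ε hε
  have hz := (Metric.tendsto_nhds.1 (tendsto_inv_lattice hΛ)) (ε / (B + 1)) (by positivity)
  rw [Filter.eventually_cofinite] at hz ⊢
  refine (hz.biUnion fun l _ => ((b.repr l.1).support.finite_toSet.image fun i => (i, l))).subset ?_
  rintro ⟨i, l⟩ hil
  have hil : ¬ dist ((b.coord i l.1 • (l.1 : C)⁻¹) * G (b i)) 0 < ε := hil
  rw [dist_zero_right, norm_mul] at hil
  simp only [Set.mem_iUnion]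
  refine ⟨l, ?_, i, ?_, rfl⟩
  · intro hl
    rw [dist_zero_right] at hl
    refine hil ?_
    calc _ ≤ ‖(l.1 : C)⁻¹‖ * (B + 1) :=
          mul_le_mul (norm_smul_le' _ _) ((hB _).trans (by linarith)) (norm_nonneg _) (norm_nonneg _)
      _ < ε := by rwa [← lt_div_iff₀ (by positivity)]
  · rw [Finset.mem_coe, Finsupp.mem_support_iff]
    intro h0
    refine hil ?_
    rw [Module.Basis.coord_apply, h0, zero_smul, norm_zero, zero_mul]
    exact hε

theorem twist_apply {M : Type*} [AddCommGroup M] [Module Fq M] (j : ℕ) (f : CTensor Fq C M)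
    (χ : Module.Dual Fq M) : (twist j f).1 χ = f.1 χ ^ Fintype.card Fq ^ j := by
  simp [twist, AlgHom.coe_pow, FiniteField.coe_frobeniusAlgHom, pow_iterate]

theorem twist_zero {M : Type*} [AddCommGroup M] [Module Fq M] (f : CTensor Fq C M) :
    twist 0 f = f :=
  Subtype.ext (LinearMap.ext fun χ => by rw [twist_apply, pow_zero, pow_one])

theorem twist_zero_right {M : Type*} [AddCommGroup M] [Module Fq M] (j : ℕ) :
    twist j (0 : CTensor Fq C M) = 0 :=
  Subtype.ext (LinearMap.ext fun χ => by simp [twist])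

variable [CompleteSpace C] [IsUltrametricDist C]

/-- After the exchange, the inner sum over the basis reassembles G(λ) from the coordinates of λ. -/
theorem tsum_coord_inv_mul_eq (hΛ : IsLocallyFinite Λ) {ι : Type*} (b : Module.Basis ι Fq Λ)
    (G : Λ →ₗ[Fq] C) {B : ℝ} (hB : ∀ l, ‖G l‖ ≤ B) :
    ∑' i, (-∑' l : {l : Λ // l ≠ 0}, b.coord i l.1 • (l.1 : C)⁻¹) * G (b i) =
      -∑' l : {l : Λ // l ≠ 0}, G l.1 * (l.1 : C)⁻¹ := by
  let F : ι → {l : Λ // l ≠ 0} → C := fun i l => (b.coord i l.1 • (l.1 : C)⁻¹) * G (b i)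
  have hsum : Summable (Function.uncurry F) :=
    NonarchimedeanAddGroup.summable_of_tendsto_cofinite_zero (tendsto_ev_zeta_terms hΛ b hB)
  have hcomm : ∑' i, ∑' l, F i l = ∑' l, ∑' i, F i l := (Summable.tsum_comm hsum).symm
  have hleft : ∀ i, (-∑' l : {l : Λ // l ≠ 0}, b.coord i l.1 • (l.1 : C)⁻¹) * G (b i) =
      -∑' l, F i l := fun i => by rw [neg_mul, ← tsum_mul_right]
  rw [tsum_congr hleft, tsum_neg, hcomm]
  refine congrArg Neg.neg (tsum_congr fun l => ?_)
  have hG : G l.1 = ∑ i ∈ (b.repr l.1).support, b.repr l.1 i • G (b i) := by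
    conv_lhs => rw [← b.linearCombination_repr l.1, Finsupp.linearCombination_apply, Finsupp.sum,
      map_sum]
    simp only [map_smul]
  rw [tsum_eq_sum (s := (b.repr l.1).support) fun i hi => by
    simp only [F]
    rw [Module.Basis.coord_apply, Finsupp.notMem_support_iff.1 hi, zero_smul, zero_mul], hG,
    Finset.sum_mul]
  refine Finset.sum_congr rfl fun i _ => ?_
  simp only [F]
  rw [Module.Basis.coord_apply, smul_mul_assoc, smul_mul_assoc, mul_comm]

theorem ev_universalZeta_apply (hΛ : IsLocallyFinite Λ) (w : CTensor Fq C (Λ →ₗ[A] P))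
    (χ : Module.Dual Fq P) :
    (ev (universalZeta Fq Λ hΛ) w).1 χ =
      -∑' l : {l : Λ // l ≠ 0}, w.1 (dualEval l.1 χ) * (l.1 : C)⁻¹ := by
  obtain ⟨B, -, hB⟩ := CTensor.exists_bound w
  exact tsum_coord_inv_mul_eq hΛ (Module.Basis.ofVectorSpace Fq Λ) (evalLattice w χ)
    fun l => hB (dualEval l χ)

theorem ev_zero_right (z : CTensor Fq C Λ) :
    ev z (0 : CTensor Fq C (Λ →ₗ[A] P)) = 0 :=
  Subtype.ext (LinearMap.ext fun χ => by simp [ev])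

end Pairing

/-! ### The dual of the module of differentials -/

section Main

variable {Fq A K C : Type*} [Field Fq] [Fintype Fq] [CommRing A] [Field K] [NormedField C]
  [CompleteSpace C] [Algebra Fq A] [Algebra Fq K] [Algebra A K] [Algebra K C]
  [IsScalarTower Fq A K] {O : ValuationSubring K} {π : K}

/-- As dπ spans Ω_{K/Fq}, the map h ↦ h dπ has a K-linear section, which makes the coefficient of η
depend A-linearly on η. -/
theorem exists_coefficient_map (hA : IsRingOfFunctionsAwayFrom Fq A O) (hC : IsCInfty Fq C O)
    (hπ : ‖algebraMap K C π‖ = (Fintype.card Fq : ℝ)⁻¹) :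
    ∃ g : Ω[A⁄Fq] →ₗ[A] K, ∀ η,
      KaehlerDifferential.map Fq Fq A K η = g η • KaehlerDifferential.D Fq K π := by
  have hspan := span_D_uniformizer_eq_top hA hC hπ
  obtain ⟨s, hs⟩ := LinearMap.exists_rightInverse_of_surjective
    (LinearMap.toSpanSingleton K Ω[K⁄Fq] (KaehlerDifferential.D Fq K π)) (by
      rw [LinearMap.range_toSpanSingleton, hspan])
  refine ⟨s.restrictScalars A ∘ₗ KaehlerDifferential.map Fq Fq A K, fun η => ?_⟩
  exact (LinearMap.congr_fun hs _).symm

variable [IsUltrametricDist C] [Algebra Fq C] [Algebra A C] [IsScalarTower Fq A C]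
  [IsScalarTower A K C]

theorem isResidue_residue (hA : IsRingOfFunctionsAwayFrom Fq A O)
    (hC : IsCInfty Fq C O) (hπ : ‖algebraMap K C π‖ = (Fintype.card Fq : ℝ)⁻¹)
    {g : Ω[A⁄Fq] →ₗ[A] K} (hg : ∀ η,
      KaehlerDifferential.map Fq Fq A K η = g η • KaehlerDifferential.D Fq K π)
    {b : C} (hb : b ∈ kInfty K C) (η : Ω[A⁄Fq]) :
    IsResidue π b η (residue Fq (algebraMap K C π) (b * algebraMap K C (g η))) := by
  have htower := isScalarTower_const Fq A K C
  obtain ⟨c, hc⟩ := exists_isExpansion hA hC hπ (mul_mem hb (algebraMap_mem_kInfty (g η)))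
  exact ⟨g η, hg η, c, hc, (hc.residue_eq hπ).symm⟩

variable [IsFractionRing A K]

/-- Every functional on `Ω` which vanishes on a suitable finite set is `η ↦ Res_∞(b η)` for a small
`b ∈ K_∞`. -/
theorem exists_forall_dual_eq_residue [IsDomain A] (hA : IsRingOfFunctionsAwayFrom Fq A O)
    (hC : IsCInfty Fq C O) (hπ : ‖algebraMap K C π‖ = (Fintype.card Fq : ℝ)⁻¹)
    {g : Ω[A⁄Fq] →ₗ[A] K} (hg : ∀ η,
      KaehlerDifferential.map Fq Fq A K η = g η • KaehlerDifferential.D Fq K π)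
    {ε : ℝ} (hε : 0 < ε) :
    ∃ S : Finset Ω[A⁄Fq], ∀ χ : Module.Dual Fq Ω[A⁄Fq], (∀ η ∈ S, χ η = 0) →
      ∃ b ∈ kInfty K C, ‖b‖ < ε ∧
        ∀ η, residue Fq (algebraMap K C π) (b * algebraMap K C (g η)) = χ η := by
  have htower := isScalarTower_const Fq A K C
  have hq := one_lt_card Fq
  have hft := finiteType_ring (K := K) hA hC
  obtain ⟨N, hN⟩ := pow_unbounded_of_one_lt ε⁻¹ hq
  -- The kernel of g is torsion because Ω_{K/Fq} is the localization of Ω_{A/Fq}. Hence finitely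
  -- many η have coefficient of norm at most q^N; they form S.
  have hfin := finite_norm_le_of_fg hA hC g (fun η hη => by
    have h0 : KaehlerDifferential.map Fq Fq A K η = 0 := by rw [hg, hη, zero_smul]
    have := KaehlerDifferential.isLocalizedModule_map Fq A K (nonZeroDivisors A)
    obtain ⟨a, ha⟩ := (IsLocalizedModule.eq_zero_iff (nonZeroDivisors A)
      (KaehlerDifferential.map Fq Fq A K)).1 h0
    exact ⟨a, nonZeroDivisors.ne_zero a.2, ha⟩) ((Fintype.card Fq : ℝ) ^ N)
  refine ⟨hfin.toFinset, fun χ hχ => ?_⟩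
  let g' : Ω[A⁄Fq] →ₗ[Fq] C :=
    (IsScalarTower.toAlgHom Fq K C).toLinearMap ∘ₗ g.restrictScalars Fq
  obtain ⟨b, hb, hbN, hbχ⟩ := exists_residue_mul_eq hA hC hπ g'
    (fun η => algebraMap_mem_kInfty (g η)) χ N fun η hη => hχ η (hfin.mem_toFinset.2 hη)
  exact ⟨b, hb, hbN.trans_lt (inv_lt_of_inv_lt₀ hε hN), hbχ⟩

/-- As a function of a small `b ∈ K_∞`, the pairing of `ζ` with the `j`-th twist of `exp_Λ` is `b`
for `j = 0`, and zero for `j > 0`. -/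
theorem exists_forall_ev_apply_eq (hA : IsRingOfFunctionsAwayFrom Fq A O)
    (hC : IsCInfty Fq C O) (hπ : ‖algebraMap K C π‖ = (Fintype.card Fq : ℝ)⁻¹)
    {g : Ω[A⁄Fq] →ₗ[A] K} (hg : ∀ η,
      KaehlerDifferential.map Fq Fq A K η = g η • KaehlerDifferential.D Fq K π)
    {Λ : Submodule A C} (hΛ : IsLocallyFinite Λ) (h0 : Λ ≠ ⊥)
    {w : CTensor Fq C (Λ →ₗ[A] Ω[A⁄Fq])} (hw : IsExponential Fq π Λ w) (j : ℕ) :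
    ∃ ε > 0, ∀ b ∈ kInfty K C, ‖b‖ < ε → ∀ χ : Module.Dual Fq Ω[A⁄Fq],
      (∀ η, residue Fq (algebraMap K C π) (b * algebraMap K C (g η)) = χ η) →
      (ev (universalZeta Fq Λ hΛ) (twist j w)).1 χ = if j = 0 then b else 0 := by
  obtain ⟨t, ht⟩ := exists_one_lt_norm (K := K) hA hC
  obtain ⟨ε, hε, h⟩ := exists_forall_tsum_latticeExp_eq (Fq := Fq) hΛ h0 ht j
  obtain ⟨B, -, hB⟩ := CTensor.exists_bound w
  refine ⟨ε, hε, fun b hb hbε χ hχ => ?_⟩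
  -- The functional n ↦ χ(n(λ)) = Res_∞(b n(λ)) is the class of bλ, on which w is exp_Λ. The bound
  -- on w therefore bounds exp_Λ(bλ) over all of Λ.
  have hexp : ∀ l : Λ, w.1 (dualEval l χ) = latticeExp Λ (b * l) := fun l =>
    hw b hb l _ fun n => by
      have := isResidue_residue hA hC hπ hg hb (n l)
      rwa [hχ] at this
  rw [ev_universalZeta_apply]
  simp only [twist_apply, hexp]
  rw [h b hbε B fun l hl => hexp ⟨l, hl⟩ ▸ hB _, neg_neg]

variable [IsDomain A]

theorem ev_twist_mem_range_ofTensor (hA : IsRingOfFunctionsAwayFrom Fq A O)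
    (hC : IsCInfty Fq C O) (hπ : ‖algebraMap K C π‖ = (Fintype.card Fq : ℝ)⁻¹)
    {Λ : Submodule A C} (hΛ : IsLocallyFinite Λ) (h0 : Λ ≠ ⊥)
    {w : CTensor Fq C (Λ →ₗ[A] Ω[A⁄Fq])} (hw : IsExponential Fq π Λ w) {j : ℕ} (hj : j ≠ 0) :
    ev (universalZeta Fq Λ hΛ) (twist j w) ∈ LinearMap.range (ofTensor Fq C Ω[A⁄Fq]) := by
  obtain ⟨g, hg⟩ := exists_coefficient_map hA hC hπ
  obtain ⟨ε, hε, h⟩ := exists_forall_ev_apply_eq hA hC hπ hg hΛ h0 hw j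
  obtain ⟨S, hS⟩ := exists_forall_dual_eq_residue hA hC hπ hg hε
  refine (mem_range_ofTensor_iff _).2 ⟨S, fun χ hχ => ?_⟩
  obtain ⟨b, hb, hbε, hbχ⟩ := hS χ hχ
  rw [h b hb hbε χ hbχ, if_neg hj]

theorem diagonal_ev_mem_range_ofTensor (hA : IsRingOfFunctionsAwayFrom Fq A O)
    (hC : IsCInfty Fq C O) (hπ : ‖algebraMap K C π‖ = (Fintype.card Fq : ℝ)⁻¹)
    {Λ : Submodule A C} (hΛ : IsLocallyFinite Λ) (h0 : Λ ≠ ⊥)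
    {w : CTensor Fq C (Λ →ₗ[A] Ω[A⁄Fq])} (hw : IsExponential Fq π Λ w) (a : A) :
    tensorAction Fq C Ω[A⁄Fq] A (algebraMap A C a ⊗ₜ[Fq] (1 : A) - (1 : C) ⊗ₜ[Fq] a)
      (ev (universalZeta Fq Λ hΛ) (twist 0 w)) ∈ LinearMap.range (ofTensor Fq C Ω[A⁄Fq]) := by
  obtain ⟨g, hg⟩ := exists_coefficient_map hA hC hπ
  obtain ⟨ε, hε, h⟩ := exists_forall_ev_apply_eq hA hC hπ hg hΛ h0 hw 0
  -- The threshold makes both b and ab smaller than ε.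
  obtain ⟨S, hS⟩ := exists_forall_dual_eq_residue hA hC hπ hg
    (ε := ε / (‖algebraMap A C a‖ + 1)) (by positivity)
  refine (mem_range_ofTensor_iff _).2 ⟨S, fun χ hχ => ?_⟩
  obtain ⟨b, hb, hbε, hbχ⟩ := hS χ hχ
  rw [lt_div_iff₀ (by positivity)] at hbε
  have hb1 : ‖b‖ < ε := lt_of_le_of_lt
    (le_mul_of_one_le_right (norm_nonneg b) (by linarith [norm_nonneg (algebraMap A C a)])) hbε
  have hb2 : ‖algebraMap A C a * b‖ < ε := by
    rw [norm_mul, mul_comm]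
    refine lt_of_le_of_lt (mul_le_mul_of_nonneg_left (by linarith) (norm_nonneg b)) hbε
  have hab : algebraMap A C a * b ∈ kInfty K C := by
    rw [IsScalarTower.algebraMap_apply A K C]
    exact mul_mem (algebraMap_mem_kInfty _) hb
  have h1 := h b hb hb1 χ hbχ
  -- Precomposing Res_∞(b ·) with multiplication by a gives Res_∞(ab ·). Hence a ⊗ 1 and 1 ⊗ a both
  -- produce the value ab, and their difference vanishes.
  have h2 := h _ hab hb2 (χ ∘ₗ Algebra.lsmul Fq Fq Ω[A⁄Fq] a) fun η => by
    have := hbχ (a • η)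
    rw [map_smul, Algebra.smul_def, map_mul, ← IsScalarTower.algebraMap_apply] at this
    rw [mul_comm (algebraMap A C a), mul_assoc, this]
    rfl
  have h3 : χ ∘ₗ Algebra.lsmul Fq Fq Ω[A⁄Fq] (1 : A) = χ :=
    LinearMap.ext fun η => congrArg χ (one_smul A η)
  rw [tensorAction_sub, Submodule.coe_sub, LinearMap.sub_apply, tensorAction_tmul,
    tensorAction_tmul, h3, h1, h2]
  simp

end Main

end DrinfeldPairing

/-! ### The main theorem -/

open DrinfeldPairing in
theorem mainTheorem1 {Fq A K C : Type*} [Field Fq] [Fintype Fq] [CommRing A] [IsDomain A]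
    [Field K] [NormedField C] [CompleteSpace C] [IsUltrametricDist C]
    [Algebra Fq A] [Algebra Fq K] [Algebra Fq C] [Algebra A K] [Algebra A C] [Algebra K C]
    [IsScalarTower Fq A K] [IsScalarTower Fq A C] [IsScalarTower A K C] [IsFractionRing A K]
    (O : ValuationSubring K) (hA : IsRingOfFunctionsAwayFrom Fq A O) (hC : IsCInfty Fq C O)
    (π : K) (hπ : ‖algebraMap K C π‖ = (Fintype.card Fq : ℝ)⁻¹)
    (r : ℕ) (hr : 0 < r) (φ : A →+* Module.End Fq C) (hφ : IsDrinfeldModule φ r)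
    (Λ : Submodule A C) (hΛ : IsPeriodLattice φ r Λ) :
    (∀ j < r, IsRational A (ev (universalZeta Fq Λ hΛ.locallyFinite) (twist j (universalOmega Fq π Λ)))) ∧
    (∀ h ∈ diagonalIdeal Fq C A,
      tensorAction Fq C Ω[A⁄Fq] A h (ev (universalZeta Fq Λ hΛ.locallyFinite) (universalOmega Fq π Λ)) ∈
        LinearMap.range (ofTensor Fq C Ω[A⁄Fq])) ∧
    (∀ j, 1 ≤ j → j < r → ∀ h : C ⊗[Fq] A,
      tensorAction Fq C Ω[A⁄Fq] A h
          (ev (universalZeta Fq Λ hΛ.locallyFinite) (twist j (universalOmega Fq π Λ))) ∈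
        LinearMap.range (ofTensor Fq C Ω[A⁄Fq])) := by
  have h0 : Λ ≠ ⊥ := by
    rintro rfl
    have := hΛ.finrank_eq
    rw [Module.finrank_zero_of_subsingleton] at this
    omega
  -- `universalOmega` is an element representing `exp_Λ`, or zero by convention if there is none;
  -- the second alternative is disposed of separately below.
  have hdiag : ∀ a : A, tensorAction Fq C Ω[A⁄Fq] A
      (algebraMap A C a ⊗ₜ[Fq] (1 : A) - (1 : C) ⊗ₜ[Fq] a)
      (ev (universalZeta Fq Λ hΛ.locallyFinite) (twist 0 (universalOmega Fq π Λ))) ∈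
        LinearMap.range (ofTensor Fq C Ω[A⁄Fq]) := by
    intro a
    by_cases hw : ∃ w, IsExponential Fq π Λ w
    · rw [universalOmega, dif_pos hw]
      exact diagonal_ev_mem_range_ofTensor hA hC hπ hΛ.locallyFinite h0 hw.choose_spec a
    · rw [universalOmega, dif_neg hw, twist_zero_right, ev_zero_right]
      exact tensorAction_mem_range_ofTensor _ (zero_mem _)
  have htwist : ∀ j ≠ 0, ev (universalZeta Fq Λ hΛ.locallyFinite)
      (twist j (universalOmega Fq π Λ)) ∈ LinearMap.range (ofTensor Fq C Ω[A⁄Fq]) := by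
    intro j hj
    by_cases hw : ∃ w, IsExponential Fq π Λ w
    · rw [universalOmega, dif_pos hw]
      exact ev_twist_mem_range_ofTensor hA hC hπ hΛ.locallyFinite h0 hw.choose_spec hj
    · rw [universalOmega, dif_neg hw, twist_zero_right, ev_zero_right]
      exact zero_mem _
  refine ⟨fun j _ => ?_, fun h hh => ?_, fun j hj _ h => ?_⟩
  · rcases eq_or_ne j 0 with rfl | hj
    -- For j = 0 the denominator is t ⊗ 1 - 1 ⊗ t with t nonconstant; for j > 0 the form is already
    -- in C ⊗ Ω and 1 suffices.
    · obtain ⟨t, ht⟩ := exists_one_lt_norm (K := K) hA hC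
      exact ⟨_, diagonal_mem_nonZeroDivisors (K := K) hA hC ht, hdiag t⟩
    · exact ⟨1, one_mem _, tensorAction_mem_range_ofTensor _ (htwist j hj)⟩
  · rw [← twist_zero (universalOmega Fq π Λ)]
    exact tensorAction_mem_range_of_mem_diagonalIdeal hdiag hh
  · exact tensorAction_mem_range_ofTensor h (htwist j (by omega))
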